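/- All manifolds, maps and functions are $C^\infty$; an immersion into Euclidean space is regarded as an isometric immersion for the metric it induces. Two maps into $\mathbb{R}^N$ are *conformally congruent* if one is the composition of the other with a similarity of $\mathbb{R}^N$, or with an inversion with respect to a hypersphere (whose centre is not attained) followed by a similarity. *Darboux transforms.* Let $f\colon M^n\to\mathbb{R}^N$ be an immersion with second fundamental form $\alpha$, normal connection $\nabla^\perp$ and shape operators $A_\xi$. Let $\varphi\in C^\infty(M)$ and let $\beta$ be a normal vector field with $\alpha(X,\nabla\varphi)+\nabla^\perp_X\beta=0$ for all $X\in TM$. Put $\mathcal F=df(\operatorname{grad}\varphi)+\beta$, $\mathcal S=\operatorname{Hess}\varphi-A_\beta$, and assume that $\mathcal F$ vanishes nowhere; put $\nu=\langle\mathcal F,\mathcal F\rangle^{-1}$ and assume that $D=I-2\nu\varphi\,\mathcal S$ is everywhere invertible. Then $\tilde f=f-2\nu\varphi\,\mathcal F$ is the Ribaucour transform of $f$ determined by $(\varphi,\beta)$. It is a *Darboux transform* of $f$ if the metrics induced by $f$ and $\tilde f$ are conformal, $\langle\,,\rangle^\sim=r^2\langle\,,\rangle$ with $r>0$, and the eigenbundles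 $E_+$ and $E_-$ of $D$ for the eigenvalues $r$ and $-r$ are both nonzero everywhere; $(E_+,E_-)$ is then called its net. **Proposition.** Let $M^n$ be a connected manifold, let $M_1,M_2$ be manifolds with $\dim M_1>1$ and $\dim M_2>1$, let $\psi\colon M_1\times M_2\to M^n$ be a diffeomorphism, and let $f\colon M^n\to\mathbb{R}^N$ be an immersion such that $f\circ\psi$ is conformally congruent to a map $g\colon M_1\times M_2\to\mathbb{R}^N$ of one of the following types: (i) $g=g_1\times g_2\colon M_1\times M_2\to\mathbb{R}^{N_1}\times\mathbb{R}^{N_2}=\mathbb{R}^N$ is an extrinsic product of immersions $g_i\colon M_i\to\mathbb{R}^{N_i}$ (the last equality being an orthogonal identification); (ii) $g=\Phi\circ(g_1\times g_2)$, where $g_1\colon M_1\to\mathbb{R}^m_+=\{h\in\mathbb{R}^m : h_m>0\}$ and $g_2\colon M_2\to\mathbb{S}^{N-m}(1)\subset\mathbb{R}^{N-m+1}$ are immersions and $\Phi\colon\mathbb{R}^m_+\times_\sigma\mathbb{S}^{N-m}(1)\to\mathbb{R}^{m-1}\times\mathbb{R}^{N-m+1}=\mathbb{R}^N$, $\Phi(h,z)=(h_1,\dots,h_{m-1},h_m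 z)$, is isometric with warping function $\sigma(h)=h_m$. Let $\tilde f\colon M^n\to\mathbb{R}^N$ be any Darboux transform of $f$ for which $\psi$ is a product representation of its net, that is, $\psi$ maps the leaves $M_1\times\{y\}$ and $\{x\}\times M_2$ onto the leaves of $E_+$ and $E_-$, respectively, or onto the leaves of $E_-$ and $E_+$, respectively. Then $\tilde f$ is conformally congruent to $f$. -/

import Mathlib

open scoped Manifold ContDiff

noncomputable section

namespace DarbouxTransform

/-- Euclidean space `ℝⁿ` with its standard inner product. -/
abbrev 𝔼 (n : ℕ) : Type := EuclideanSpace ℝ (Fin n)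

section Conformal

/-- `f` and `f'` are conformally congruent: they differ by a conformal transformation of `ℝᴺ`, that
is, by a similarity `L` or by a composition `L ∘ I` of a similarity `L` with the inversion `I`
with respect to a hypersphere of centre `p₀` and radius `R`, where `p₀` is not attained by `f`. -/
def ConformallyCongruent {X : Type*} {N : ℕ} (f f' : X → 𝔼 N) : Prop :=
  (∃ L : 𝔼 N ≃ᵈ 𝔼 N, ∀ x, f' x = L (f x)) ∨
  (∃ (L : 𝔼 N ≃ᵈ 𝔼 N) (p₀ : 𝔼 N) (R : ℝ), 0 < R ∧ (∀ x, f x ≠ p₀) ∧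
    ∀ x, f' x = L (EuclideanGeometry.inversion p₀ R (f x)))

end Conformal

section Submanifold

variable (n : ℕ) {N : ℕ} {M : Type*} [TopologicalSpace M] [ChartedSpace (𝔼 n) M]

/-- The differential `d_p f : T_p M → ℝᴺ` of a map `f : M → ℝᴺ`. -/
def differential (f : M → 𝔼 N) (p : M) : TangentSpace (𝓡 n) p →ₗ[ℝ] 𝔼 N :=
  (mfderiv (𝓡 n) 𝓘(ℝ, 𝔼 N) f p).toLinearMap

/-- `f` is a smooth immersion (between boundaryless finite-dimensional manifolds): it is smooth and its differential is injective everywhere. -/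
def IsSmoothImmersion (f : M → 𝔼 N) : Prop :=
  ContMDiff (𝓡 n) 𝓘(ℝ, 𝔼 N) ∞ f ∧ ∀ p, Function.Injective (differential n f p)

/-- The metric induced by `f`. -/
def inducedMetric (f : M → 𝔼 N) (p : M) (X Y : TangentSpace (𝓡 n) p) : ℝ :=
  inner ℝ (differential n f p X) (differential n f p Y)

/-- The subspace `d_p f (T_p M)` of `ℝᴺ`. -/
def tangentImage (f : M → 𝔼 N) (p : M) : Submodule ℝ (𝔼 N) :=
  LinearMap.range (differential n f p)

/-- The component of a vector `v` of `ℝᴺ` normal to `f` at `p`. -/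
def normalComponent (f : M → 𝔼 N) (p : M) : 𝔼 N →ₗ[ℝ] 𝔼 N :=
  (tangentImage n f p)ᗮ.starProjection.toLinearMap

/-- The tangential component of a vector `v` of `ℝᴺ` as an element of `T_p M`: the vector `X` such
that `d_p f X` is the orthogonal projection of `v` to `d_p f (T_p M)`. -/
def tangentialComponent (f : M → 𝔼 N) (p : M) : 𝔼 N →ₗ[ℝ] TangentSpace (𝓡 n) p :=
  (differential n f p).leftInverse ∘ₗ (tangentImage n f p).starProjection.toLinearMap

theorem differential_tangentialComponent {f : M → 𝔼 N} (hf : IsSmoothImmersion n f) (p : M)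
    (v : 𝔼 N) :
    differential n f p (tangentialComponent n f p v) = (tangentImage n f p).starProjection v := by
  have hv : (tangentImage n f p).starProjection v ∈ LinearMap.range (differential n f p) :=
    Submodule.starProjection_apply_mem _ v
  obtain ⟨X, hX⟩ := hv
  simp only [tangentialComponent, LinearMap.comp_apply, ContinuousLinearMap.coe_coe]
  rw [← hX, LinearMap.leftInverse_apply_of_inj (LinearMap.ker_eq_bot.2 (hf.2 p))]

theorem tangentialComponent_differential {f : M → 𝔼 N} (hf : IsSmoothImmersion n f) (p : M)
    (X : TangentSpace (𝓡 n) p) :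
    tangentialComponent n f p (differential n f p X) = X := by
  apply hf.2 p
  rw [differential_tangentialComponent n hf]
  exact Submodule.starProjection_eq_self_iff.2 (LinearMap.mem_range_self _ X)

/-- The differential of a real function on `M`. -/
def differentialReal (φ : M → ℝ) (p : M) : TangentSpace (𝓡 n) p →ₗ[ℝ] ℝ :=
  (mfderiv (𝓡 n) 𝓘(ℝ, ℝ) φ p).toLinearMap

/-- The gradient of `φ` with respect to the metric induced by `f`: the tangential component of the
vector of `ℝᴺ` that represents the linear functional `d_p φ`. -/
def grad (f : M → 𝔼 N) (φ : M → ℝ) (p : M) : TangentSpace (𝓡 n) p :=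
  tangentialComponent n f p ((InnerProductSpace.toDual ℝ (𝔼 N)).symm
    (LinearMap.toContinuousLinearMap (differentialReal n φ p ∘ₗ tangentialComponent n f p)))

/-- The defining property of the gradient. -/
theorem inducedMetric_grad {f : M → 𝔼 N} (hf : IsSmoothImmersion n f) (φ : M → ℝ) (p : M)
    (X : TangentSpace (𝓡 n) p) :
    inducedMetric n f p (grad n f φ p) X = differentialReal n φ p X := by
  have hX : (tangentImage n f p).starProjection (differential n f p X) = differential n f p X :=
    Submodule.starProjection_eq_self_iff.2 (LinearMap.mem_range_self _ X)
  rw [inducedMetric, grad, differential_tangentialComponent n hf,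
    Submodule.inner_starProjection_left_eq_right, hX, InnerProductSpace.toDual_symm_apply]
  simp [tangentialComponent_differential n hf]

/-- The Levi-Civita derivative `X ↦ ∇_X Y` of a vector field `Y` for the metric induced by `f`: the
tangential component of the derivative of `df(Y)` in `ℝᴺ`. -/
def leviCivita (f : M → 𝔼 N) (Y : ∀ p : M, TangentSpace (𝓡 n) p) (p : M) :
    TangentSpace (𝓡 n) p →ₗ[ℝ] TangentSpace (𝓡 n) p :=
  tangentialComponent n f p ∘ₗ differential n (fun q => differential n f q (Y q)) p

/-- The second fundamental form `X ↦ α(X, Y)` of `f`: the normal component of the derivative of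
`df(Y)` in `ℝᴺ`. -/
def secondFundamentalForm (f : M → 𝔼 N) (Y : ∀ p : M, TangentSpace (𝓡 n) p) (p : M) :
    TangentSpace (𝓡 n) p →ₗ[ℝ] 𝔼 N :=
  normalComponent n f p ∘ₗ differential n (fun q => differential n f q (Y q)) p

/-- The normal connection `X ↦ ∇^⊥_X β` of `f`. -/
def normalConnection (f : M → 𝔼 N) (β : M → 𝔼 N) (p : M) : TangentSpace (𝓡 n) p →ₗ[ℝ] 𝔼 N :=
  normalComponent n f p ∘ₗ differential n β p

/-- The shape operator `A_β` of `f`. -/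
def shapeOperator (f : M → 𝔼 N) (β : M → 𝔼 N) (p : M) :
    TangentSpace (𝓡 n) p →ₗ[ℝ] TangentSpace (𝓡 n) p :=
  -(tangentialComponent n f p ∘ₗ differential n β p)

/-- The Hessian `X ↦ ∇_X grad φ` of `φ` for the metric induced by `f`. -/
def hess (f : M → 𝔼 N) (φ : M → ℝ) (p : M) :
    TangentSpace (𝓡 n) p →ₗ[ℝ] TangentSpace (𝓡 n) p :=
  leviCivita n f (grad n f φ) p

/-- The vector field `𝓕 = df(grad φ) + β` along `f`. -/
def ribaucourField (f : M → 𝔼 N) (φ : M → ℝ) (β : M → 𝔼 N) (p : M) : 𝔼 N :=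
  differential n f p (grad n f φ p) + β p

/-- The tensor `S_{φ,β} = Hess φ - A_β`. -/
def codazziTensor (f : M → 𝔼 N) (φ : M → ℝ) (β : M → 𝔼 N) (p : M) :
    TangentSpace (𝓡 n) p →ₗ[ℝ] TangentSpace (𝓡 n) p :=
  hess n f φ p - shapeOperator n f β p

/-- The function `ν = 1 / ⟨𝓕, 𝓕⟩`. -/
def nu (f : M → 𝔼 N) (φ : M → ℝ) (β : M → 𝔼 N) (p : M) : ℝ :=
  (inner ℝ (ribaucourField n f φ β p) (ribaucourField n f φ β p))⁻¹

/-- The tensor `D = I - 2 ν φ S_{φ,β}`. -/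
def ribaucourTensor (f : M → 𝔼 N) (φ : M → ℝ) (β : M → 𝔼 N) (p : M) :
    TangentSpace (𝓡 n) p →ₗ[ℝ] TangentSpace (𝓡 n) p :=
  LinearMap.id - (2 * nu n f φ β p * φ p) • codazziTensor n f φ β p

/-- `f' = R_{φ,β}(f)` is the Ribaucour transform of `f` determined by the smooth function `φ` and
the smooth normal vector field `β`. -/
structure IsRibaucourTransform (f f' : M → 𝔼 N) (φ : M → ℝ) (β : M → 𝔼 N) : Prop where
  smooth_phi : ContMDiff (𝓡 n) 𝓘(ℝ, ℝ) ∞ φ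
  smooth_beta : ContMDiff (𝓡 n) 𝓘(ℝ, 𝔼 N) ∞ β
  normal_beta : ∀ p, β p ∈ (tangentImage n f p)ᗮ
  compat : ∀ (p : M) (X : TangentSpace (𝓡 n) p),
    secondFundamentalForm n f (grad n f φ) p X + normalConnection n f β p X = 0
  field_ne_zero : ∀ p, ribaucourField n f φ β p ≠ 0
  bijective_tensor : ∀ p, Function.Bijective (ribaucourTensor n f φ β p)
  eq_transform : ∀ p, f' p = f p - (2 * nu n f φ β p * φ p) • ribaucourField n f φ β p

/-- `f'` is a Darboux transform of `f` with orthogonal net `(E₊, E₋)`: it is a Ribaucour transform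
of `f`, the metrics induced by `f` and `f'` are conformal with factor `r²`, and the
eigenbundles `E₊` and `E₋` of the tensor `D` for the eigenvalues `r` and `-r` are both nonzero. -/
def IsDarbouxTransform (f f' : M → 𝔼 N)
    (Eplus Eminus : ∀ p : M, Submodule ℝ (TangentSpace (𝓡 n) p)) : Prop :=
  ∃ (φ : M → ℝ) (β : M → 𝔼 N) (r : M → ℝ),
    IsRibaucourTransform n f f' φ β ∧
    (∀ p, 0 < r p) ∧
    (∀ (p : M) (X Y : TangentSpace (𝓡 n) p),
      inducedMetric n f' p X Y = r p ^ 2 * inducedMetric n f p X Y) ∧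
    (∀ p, Eplus p = Module.End.eigenspace (ribaucourTensor n f φ β p) (r p)) ∧
    (∀ p, Eminus p = Module.End.eigenspace (ribaucourTensor n f φ β p) (-r p)) ∧
    (∀ p, Eplus p ≠ ⊥) ∧ (∀ p, Eminus p ≠ ⊥)

end Submanifold

/- `IsProductRepresentation` is phrased through tangent spaces: since the slices `M₁ × {y}` and
`{x} × M₂` partition the product, their images are the leaves of `E₁` and `E₂` exactly when they
are tangent to them. -/

section Products

variable {n n₁ n₂ N : ℕ}
  {M : Type*} [TopologicalSpace M] [ChartedSpace (𝔼 n) M]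
  {M₁ : Type*} [TopologicalSpace M₁] [ChartedSpace (𝔼 n₁) M₁]
  {M₂ : Type*} [TopologicalSpace M₂] [ChartedSpace (𝔼 n₂) M₂]

/-- The diffeomorphism `ψ : M₁ × M₂ → M` is a product representation of `(E₁, E₂)`: it maps the
leaves `M₁ × {y}` to leaves of `E₁` and the leaves `{x} × M₂` to leaves of `E₂`. -/
def IsProductRepresentation (ψ : (M₁ × M₂) ≃ₘ^∞⟮(𝓡 n₁).prod (𝓡 n₂), 𝓡 n⟯ M)
    (E₁ E₂ : ∀ p : M, Submodule ℝ (TangentSpace (𝓡 n) p)) : Prop :=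
  ∀ (x : M₁) (y : M₂),
    LinearMap.range (mfderiv (𝓡 n₁) (𝓡 n) (fun x' => ψ (x', y)) x).toLinearMap = E₁ (ψ (x, y)) ∧
    LinearMap.range (mfderiv (𝓡 n₂) (𝓡 n) (fun y' => ψ (x, y')) y).toLinearMap = E₂ (ψ (x, y))

/-- `g = g₁ × g₂ : M₁ × M₂ → ℝ^{N₁} × ℝ^{N₂} = ℝᴺ` is an extrinsic product of immersions, for some
orthogonal identification `e` of `ℝ^{N₁} × ℝ^{N₂}` with `ℝᴺ`. -/
def IsExtrinsicProduct (n₁ n₂ : ℕ) {N : ℕ}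
    {M₁ : Type*} [TopologicalSpace M₁] [ChartedSpace (𝔼 n₁) M₁]
    {M₂ : Type*} [TopologicalSpace M₂] [ChartedSpace (𝔼 n₂) M₂] (g : M₁ × M₂ → 𝔼 N) : Prop :=
  ∃ (N₁ N₂ : ℕ) (e : WithLp 2 (𝔼 N₁ × 𝔼 N₂) ≃ₗᵢ[ℝ] 𝔼 N) (g₁ : M₁ → 𝔼 N₁) (g₂ : M₂ → 𝔼 N₂),
    IsSmoothImmersion n₁ g₁ ∧ IsSmoothImmersion n₂ g₂ ∧
    ∀ x y, g (x, y) = e (WithLp.toLp 2 (g₁ x, g₂ y))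

/-- `g = Φ ∘ (g₁ × g₂)` is a warped product of the immersions `g₁ : M₁ → ℝᵐ₊` and
`g₂ : M₂ → 𝕊ᵏ⁻¹(1) ⊂ ℝᵏ`, where `m = l + 1`, `ℝᵐ₊` is the half-space on which the last coordinate
is positive, and `Φ : ℝᵐ₊ ×_σ 𝕊ᵏ⁻¹(1) → ℝˡ × ℝᵏ = ℝᴺ` is the isometry
`Φ(h₁, …, h_m, z) = (h₁, …, h_{m-1}, h_m z)` onto its image, with warping function `σ = h_m`. -/
def IsWarpedProduct (n₁ n₂ : ℕ) {N : ℕ}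
    {M₁ : Type*} [TopologicalSpace M₁] [ChartedSpace (𝔼 n₁) M₁]
    {M₂ : Type*} [TopologicalSpace M₂] [ChartedSpace (𝔼 n₂) M₂] (g : M₁ × M₂ → 𝔼 N) : Prop :=
  ∃ (l k : ℕ) (e : WithLp 2 (𝔼 l × 𝔼 k) ≃ₗᵢ[ℝ] 𝔼 N) (g₁ : M₁ → 𝔼 (l + 1)) (g₂ : M₂ → 𝔼 k),
    IsSmoothImmersion n₁ g₁ ∧ IsSmoothImmersion n₂ g₂ ∧
    (∀ x, 0 < g₁ x (Fin.last l)) ∧ (∀ y, ‖g₂ y‖ = 1) ∧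
    ∀ x y, g (x, y) =
      e (WithLp.toLp 2 (WithLp.toLp 2 (fun i : Fin l => g₁ x i.castSucc),
        g₁ x (Fin.last l) • g₂ y))

end Products

end DarbouxTransform

end

/-! Conformal geometry of `ℝᴺ` becomes linear in the light cone of the Lorentzian space `E × ℝ × ℝ`.
A point `v` is represented by the null vector `nullLift v = (v, 1, ‖v‖²)`, two points have product
`-‖v - w‖² / 2`, and Lorentzian isometries act as conformal maps. The goal is one linear involution,
independent of the point, that carries the lift of `f` to a multiple of the lift of `f'`.

Write `h = f ∘ ψ` and `G = (F, 0, 2(⟨F, h⟩ - φ))`. The Ribaucour transform is the reflection of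
`nullLift h` in the varying vector `G` (`smul_nullLift_ribaucour`). On an eigenbundle of `D` the
differential of `F` is a multiple of that of `h`, and `dφ = ⟨F, dh⟩`; hence `dG = λ d(nullLift h)`
along `M₁` and `dG = μ d(nullLift h)` along `M₂`. Each factor has dimension at least two, so
symmetry of second derivatives makes `λ` constant along `M₁` and `μ` constant along `M₂`.
Integration gives `G = λ nullLift h + a(y) = μ nullLift h + b(x)`, so that `(λ - μ) nullLift h =
b(x) - a(y)`. Since `λ + μ = ‖F‖² / φ`, the reflection formula gives `(‖F‖² / φ) nullLift h' =
-(a(y) + b(x))`.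

The product structure of `g` enters through a second splitting: in both types `nullLift h = σ (P(x)
+ Q(y))`, and this property survives conformal changes (`HasAdditiveLift.congr`). Comparison of the
two splittings shows that `(λ - μ) σ` is a constant `C` (`exists_eq_const_of_smul_add_eq`). After
renaming `P = b / C` and `Q = -a / C`, the lifts of `h` and `h'` are proportional to `P + Q` and `Q
- P`.

Nullity of both combinations forces `P ⊥ Q` and makes `⟨P, P⟩ = -⟨Q, Q⟩` constant. If this constant
is nonzero, one family is timelike and the span of the other is positive definite, so an orthogonal
reflection changes the relative sign of `P` and `Q`. If it vanishes, null vectors orthogonal to a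
common nonzero null vector are mutually orthogonal, which contradicts that `h` is an immersion
(`conformallyCongruent_of_lift_eq_add`). The resulting Lorentzian involution is a conformal map of
`ℝᴺ` (`conformallyCongruent_of_lorentz`). -/

noncomputable section

namespace DarbouxTransform

/-! ### The light cone model of conformal geometry -/

section LightCone

variable {E : Type*} [NormedAddCommGroup E] [InnerProductSpace ℝ E]

/-- The Lorentzian form on `E × ℝ × ℝ` whose light cone models the conformal geometry of `E`. -/
def lorentz : LinearMap.BilinForm ℝ (E × ℝ × ℝ) :=
  LinearMap.mk₂ ℝ (fun v w => inner ℝ v.1 w.1 - (v.2.1 * w.2.2 + v.2.2 * w.2.1) / 2)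
    (fun v v' w => by simp [inner_add_left]; ring)
    (fun c v w => by simp [inner_smul_left]; ring)
    (fun v w w' => by simp [inner_add_right]; ring)
    (fun c v w => by simp [inner_smul_right]; ring)

theorem lorentz_apply (v w : E × ℝ × ℝ) :
    lorentz v w = inner ℝ v.1 w.1 - (v.2.1 * w.2.2 + v.2.2 * w.2.1) / 2 := rfl

theorem lorentz_comm (v w : E × ℝ × ℝ) : lorentz v w = lorentz w v := by
  rw [lorentz_apply, lorentz_apply, real_inner_comm]; ring

theorem lorentz_self (v : E × ℝ × ℝ) : lorentz v v = ‖v.1‖ ^ 2 - v.2.1 * v.2.2 := by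
  rw [lorentz_apply, real_inner_self_eq_norm_sq]; ring

theorem lorentz_isRefl : (lorentz (E := E)).IsRefl := fun v w h => by rw [lorentz_comm]; exact h

/-- The null vector representing a point of `E`. -/
def nullLift (v : E) : E × ℝ × ℝ := (v, 1, ‖v‖ ^ 2)

/-- The null vector representing the point at infinity. -/
def nullInfinity : E × ℝ × ℝ := (0, 0, 1)

theorem lorentz_nullLift_self (v : E) : lorentz (nullLift v) (nullLift v) = 0 := by
  rw [lorentz_self]; simp [nullLift]

theorem lorentz_nullLift (v w : E) :
    lorentz (nullLift v) (nullLift w) = -(‖v - w‖ ^ 2 / 2) := by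
  rw [lorentz_apply, norm_sub_sq_real]; simp only [nullLift]; ring

theorem lorentz_nullInfinity (v : E × ℝ × ℝ) : lorentz v nullInfinity = -(v.2.1 / 2) := by
  rw [lorentz_apply]; simp [nullInfinity]

theorem eq_smul_nullLift {w : E × ℝ × ℝ} (hw : lorentz w w = 0) (h : w.2.1 ≠ 0) :
    w = w.2.1 • nullLift (w.2.1⁻¹ • w.1) := by
  obtain ⟨v, s, t⟩ := w
  rw [lorentz_self] at hw
  simp only at hw h
  have : ‖v‖ ^ 2 = s * t := by linarith
  simp only [nullLift, Prod.smul_mk, smul_smul, smul_eq_mul, norm_smul, mul_pow, this,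
    Real.norm_eq_abs, sq_abs, mul_inv_cancel₀ h, one_smul, mul_one, Prod.mk.injEq, true_and]
  field_simp

theorem nullLift_inj_of_smul {v w : E} {s t : ℝ} (hs : s ≠ 0)
    (h : s • nullLift v = t • nullLift w) : v = w := by
  simp only [nullLift, Prod.smul_mk, Prod.mk.injEq, smul_eq_mul, mul_one] at h
  obtain ⟨h1, rfl, -⟩ := h
  exact smul_right_injective E hs h1

/-- A vector orthogonal to a timelike vector is spacelike. -/
theorem lorentz_pos_of_timelike {p w : E × ℝ × ℝ} (hp : lorentz p p < 0)
    (hpw : lorentz p w = 0) (hw : w ≠ 0) : 0 < lorentz w w := by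
  obtain ⟨p, a, b⟩ := p
  obtain ⟨w, c, d⟩ := w
  rw [lorentz_self] at hp ⊢
  rw [lorentz_apply] at hpw
  simp only at hp hpw ⊢
  have hcs := abs_real_inner_le_norm p w
  have hcs2 : (inner ℝ p w) ^ 2 ≤ ‖p‖ ^ 2 * ‖w‖ ^ 2 := by
    rw [← mul_pow, ← sq_abs]; gcongr
  have hi : inner ℝ p w = (a * d + b * c) / 2 := by linarith
  rw [hi] at hcs2
  by_contra! hneg
  have hp0 := sq_nonneg ‖p‖
  have hw0 := sq_nonneg ‖w‖
  rcases lt_or_eq_of_le (show 0 ≤ c * d by linarith) with hcd | hcd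
  · have h1 : ‖p‖ ^ 2 * ‖w‖ ^ 2 ≤ ‖p‖ ^ 2 * (c * d) := by gcongr; linarith
    have h2 : ‖p‖ ^ 2 * (c * d) < a * b * (c * d) := by gcongr; linarith
    nlinarith [sq_nonneg (a * d - b * c)]
  · have hw1 : ‖w‖ ^ 2 = 0 := by linarith
    have hw2 : w = 0 := by simpa using hw1
    have hab : 0 < a * b := by linarith
    subst hw2
    have h3 : a * d + b * c = 0 := by
      rw [hw1, mul_zero] at hcs2
      have := le_antisymm hcs2 (sq_nonneg _)
      have := pow_eq_zero_iff (two_ne_zero) |>.1 this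
      linarith
    have ha : a ≠ 0 := by rintro rfl; simp at hab
    have hb : b ≠ 0 := by rintro rfl; simp at hab
    apply hw
    rcases mul_eq_zero.1 hcd.symm with rfl | rfl
    · simp [ha] at h3; simp [h3]
    · simp [hb] at h3; simp [h3]

/-- A vector orthogonal to a nonzero null vector is not timelike. -/
theorem lorentz_nonneg_of_null {q w : E × ℝ × ℝ} (hq : lorentz q q = 0) (hq0 : q ≠ 0)
    (hqw : lorentz q w = 0) : 0 ≤ lorentz w w := by
  by_contra! h
  exact (lorentz_pos_of_timelike h (by rw [lorentz_comm]; exact hqw) hq0).ne' hq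

/-- The form is positive semidefinite on the orthogonal complement of a nonzero null vector. Applied
to `p + p'` and `p - p'`, whose squares are `±2 ⟨p, p'⟩`, this leaves only zero. -/
theorem lorentz_eq_zero_of_null {q p p' : E × ℝ × ℝ} (hq : lorentz q q = 0) (hq0 : q ≠ 0)
    (hp : lorentz p p = 0) (hp' : lorentz p' p' = 0) (hqp : lorentz q p = 0)
    (hqp' : lorentz q p' = 0) : lorentz p p' = 0 := by
  have h1 := lorentz_nonneg_of_null hq hq0 (w := p + p') (by rw [map_add, hqp, hqp', add_zero])
  have h2 := lorentz_nonneg_of_null hq hq0 (w := p - p') (by rw [map_sub, hqp, hqp', sub_zero])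
  simp only [map_add, map_sub, LinearMap.add_apply, LinearMap.sub_apply, hp, hp',
    lorentz_comm p' p] at h1 h2
  linarith

/-- If two families of vectors are mutually orthogonal and one of them is timelike, some
orthogonal involution fixes the second one and reverses the first one. -/
theorem exists_lorentz_reflection [FiniteDimensional ℝ E] {X Y : Type*} [Nonempty X]
    {P : X → E × ℝ × ℝ} {Q : Y → E × ℝ × ℝ} (hP : ∀ x, lorentz (P x) (P x) < 0)
    (hPQ : ∀ x y, lorentz (P x) (Q y) = 0) :
    ∃ T : (E × ℝ × ℝ) →ₗ[ℝ] (E × ℝ × ℝ), (∀ v w, lorentz (T v) (T w) = lorentz v w) ∧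
      (∀ v, T (T v) = v) ∧ (∀ x, T (P x) = -P x) ∧ ∀ y, T (Q y) = Q y := by
  obtain ⟨x₀⟩ := ‹Nonempty X›
  set V := Submodule.span ℝ (Set.range Q)
  have horth : ∀ x, ∀ v ∈ V, lorentz (P x) v = 0 := fun x v hv => by
    induction hv using Submodule.span_induction with
    | mem v hv => obtain ⟨y, rfl⟩ := hv; exact hPQ x y
    | zero => simp
    | add v w _ _ hv hw => rw [map_add, hv, hw, add_zero]
    | smul c v _ hv => rw [map_smul, hv, smul_zero]
  -- All of `V` is orthogonal to the timelike vector `P x₀`, so the form is positive definite on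
  -- `V`.
  have hnd : ((lorentz (E := E)).restrict V).Nondegenerate := by
    have hr : ((lorentz (E := E)).restrict V).IsRefl := fun v w h => by
      simp only [LinearMap.BilinForm.restrict_apply, LinearMap.domRestrict_apply] at h ⊢
      rw [lorentz_comm]; exact h
    refine (LinearMap.IsRefl.nondegenerate_iff_separatingLeft (B := lorentz.restrict V) hr).2 ?_
    intro v hv
    by_contra h0
    have := lorentz_pos_of_timelike (hP x₀) (horth x₀ v v.2) (by simpa using h0)
    exact this.ne' (hv v)
  have hc := LinearMap.BilinForm.isCompl_orthogonal_of_restrict_nondegenerate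
    (lorentz_isRefl (E := E)) hnd
  have hdec : ∀ v : E × ℝ × ℝ, ∃ a ∈ V, ∃ b ∈ lorentz.orthogonal V, a + b = v := fun v =>
    Submodule.mem_sup.1 (hc.sup_eq_top ▸ Submodule.mem_top)
  -- The orthogonal reflection that is `1` on `V` and `-1` on its complement.
  let T : (E × ℝ × ℝ) →ₗ[ℝ] (E × ℝ × ℝ) := (2 : ℝ) • Submodule.projection _ _ hc - LinearMap.id
  have hT : ∀ a ∈ V, ∀ b ∈ lorentz.orthogonal V, T (a + b) = a - b := fun a ha b hb => by
    have h1 : Submodule.projection _ _ hc a = a := Submodule.projection_apply_left hc ⟨a, ha⟩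
    have h2 : Submodule.projection _ _ hc b = 0 :=
      (Submodule.projection_apply_eq_zero_iff hc).2 hb
    simp only [T, LinearMap.sub_apply, LinearMap.smul_apply, LinearMap.id_apply, map_add, h1, h2]
    module
  have hV : ∀ a ∈ V, T a = a := fun a ha => by simpa using hT a ha 0 (Submodule.zero_mem _)
  have hO : ∀ b ∈ lorentz.orthogonal V, T b = -b := fun b hb => by
    simpa using hT 0 (Submodule.zero_mem _) b hb
  have hab : ∀ a ∈ V, ∀ b ∈ lorentz.orthogonal V, lorentz a b = 0 := fun a ha b hb =>
    LinearMap.BilinForm.mem_orthogonal_iff.1 hb a ha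
  refine ⟨T, fun v w => ?_, fun v => ?_, fun x => hO _ ?_, fun y => hV _ ?_⟩
  · obtain ⟨a, ha, b, hb, rfl⟩ := hdec v
    obtain ⟨c, hc', d, hd, rfl⟩ := hdec w
    rw [hT a ha b hb, hT c hc' d hd]
    simp only [map_add, map_sub, LinearMap.add_apply, LinearMap.sub_apply, hab a ha d hd,
      lorentz_comm b c, hab c hc' b hb]
    ring
  · obtain ⟨a, ha, b, hb, rfl⟩ := hdec v
    rw [hT a ha b hb, map_sub, hV a ha, hO b hb]; abel
  · rw [LinearMap.BilinForm.mem_orthogonal_iff]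
    intro v hv
    rw [lorentz_comm]; exact horth x v hv
  · exact Submodule.subset_span ⟨y, rfl⟩

/-- The action of a translation on the light cone model. -/
def lorentzTranslation (a : E) : (E × ℝ × ℝ) →ₗ[ℝ] (E × ℝ × ℝ) where
  toFun w := (w.1 + w.2.1 • a, w.2.1, w.2.2 + 2 * inner ℝ w.1 a + w.2.1 * ‖a‖ ^ 2)
  map_add' v w := by
    simp only [Prod.fst_add, Prod.snd_add, inner_add_left, Prod.mk_add_mk, Prod.mk.injEq]
    exact ⟨by module, trivial, by ring⟩
  map_smul' c v := by
    simp only [Prod.smul_fst, Prod.smul_snd, inner_smul_left, Prod.smul_mk, Prod.mk.injEq,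
      smul_eq_mul, RingHom.id_apply]
    exact ⟨by module, trivial, by simp; ring⟩

theorem lorentzTranslation_apply (a : E) (w : E × ℝ × ℝ) : lorentzTranslation a w =
    (w.1 + w.2.1 • a, w.2.1, w.2.2 + 2 * inner ℝ w.1 a + w.2.1 * ‖a‖ ^ 2) := rfl

theorem lorentzTranslation_nullLift (a v : E) :
    lorentzTranslation a (nullLift v) = nullLift (v + a) := by
  simp [lorentzTranslation_apply, nullLift, norm_add_sq_real]

theorem lorentz_lorentzTranslation (a : E) (v w : E × ℝ × ℝ) :
    lorentz (lorentzTranslation a v) (lorentzTranslation a w) = lorentz v w := by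
  simp only [lorentz_apply, lorentzTranslation_apply, inner_add_left, inner_add_right,
    inner_smul_left, inner_smul_right, real_inner_self_eq_norm_sq, real_inner_comm w.1 a]
  simp
  ring

theorem lorentzTranslation_neg (a : E) (w : E × ℝ × ℝ) :
    lorentzTranslation a (lorentzTranslation (-a) w) = w := by
  obtain ⟨v, s, t⟩ := w
  simp only [lorentzTranslation_apply, Prod.mk.injEq, inner_add_left, inner_smul_left,
    inner_neg_left, inner_neg_right, norm_neg, real_inner_self_eq_norm_sq]
  exact ⟨by module, trivial, by simp; ring⟩

/-- The action of the inversion in the unit sphere at the origin on the light cone model. -/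
def lorentzSwap : (E × ℝ × ℝ) →ₗ[ℝ] (E × ℝ × ℝ) where
  toFun w := (w.1, w.2.2, w.2.1)
  map_add' _ _ := rfl
  map_smul' _ _ := rfl

theorem lorentz_lorentzSwap (v w : E × ℝ × ℝ) :
    lorentz (lorentzSwap v) (lorentzSwap w) = lorentz v w := by
  simp only [lorentz_apply, lorentzSwap, LinearMap.coe_mk, AddHom.coe_mk]; ring

theorem lorentzSwap_nullLift {v : E} (hv : v ≠ 0) :
    lorentzSwap (nullLift v) = ‖v‖ ^ 2 • nullLift ((‖v‖ ^ 2)⁻¹ • v) := by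
  have h : ‖v‖ ≠ 0 := norm_ne_zero_iff.2 hv
  simp only [lorentzSwap, nullLift, LinearMap.coe_mk, AddHom.coe_mk, Prod.smul_mk, smul_smul,
    smul_eq_mul, norm_smul, Prod.mk.injEq, norm_inv, norm_pow, norm_norm, mul_one]
  refine ⟨?_, trivial, ?_⟩
  · rw [mul_inv_cancel₀ (pow_ne_zero 2 h), one_smul]
  · field_simp

/-- The action of the inversion in the unit sphere at `a` on the light cone model. -/
def lorentzInversion (a : E) : (E × ℝ × ℝ) →ₗ[ℝ] (E × ℝ × ℝ) :=
  lorentzTranslation a ∘ₗ lorentzSwap ∘ₗ lorentzTranslation (-a)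

theorem lorentzInversion_apply (a : E) (w : E × ℝ × ℝ) : lorentzInversion a w =
    lorentzTranslation a (lorentzSwap (lorentzTranslation (-a) w)) := rfl

theorem lorentz_lorentzInversion (a : E) (v w : E × ℝ × ℝ) :
    lorentz (lorentzInversion a v) (lorentzInversion a w) = lorentz v w := by
  simp only [lorentzInversion_apply, lorentz_lorentzTranslation, lorentz_lorentzSwap]

theorem lorentzInversion_lorentzInversion (a : E) (w : E × ℝ × ℝ) :
    lorentzInversion a (lorentzInversion a w) = w := by
  have h := lorentzTranslation_neg (-a) (lorentzSwap (lorentzTranslation (-a) w))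
  rw [neg_neg] at h
  rw [lorentzInversion_apply, lorentzInversion_apply, h]
  exact lorentzTranslation_neg a w

theorem lorentzInversion_nullLift {a v : E} (hv : v ≠ a) : lorentzInversion a (nullLift v) =
    ‖v - a‖ ^ 2 • nullLift (EuclideanGeometry.inversion a 1 v) := by
  rw [lorentzInversion_apply, lorentzTranslation_nullLift, ← sub_eq_add_neg,
    lorentzSwap_nullLift (sub_ne_zero.2 hv), map_smul, lorentzTranslation_nullLift]
  simp [EuclideanGeometry.inversion, dist_eq_norm]

theorem lorentzInversion_nullInfinity (a : E) :
    lorentzInversion a nullInfinity = nullLift a := by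
  simp [lorentzInversion_apply, lorentzTranslation_apply, lorentzSwap, nullInfinity, nullLift]

/-- A Lorentzian isometry that fixes the point at infinity acts on `E` as a similarity. -/
theorem exists_dilationEquiv_of_lorentz {T S : (E × ℝ × ℝ) →ₗ[ℝ] (E × ℝ × ℝ)}
    (hT : ∀ v w, lorentz (T v) (T w) = lorentz v w) (hTS : ∀ v, T (S v) = v)
    (hST : ∀ v, S (T v) = v) {c : ℝ} (hc : T nullInfinity = c • nullInfinity) :
    ∃ L : E ≃ᵈ E, ∀ v, T (nullLift v) = c⁻¹ • nullLift (L v) := by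
  have hc0 : c ≠ 0 := by
    rintro rfl
    rw [zero_smul] at hc
    have h := hST nullInfinity
    rw [hc, map_zero] at h
    simp [nullInfinity, Prod.ext_iff] at h
  have hnull : ∀ v, lorentz (T (nullLift v)) (T (nullLift v)) = 0 := fun v => by
    rw [hT, lorentz_nullLift_self]
  -- The product with the point at infinity is `-1/2` times the middle coordinate, so an isometry
  -- that scales infinity by `c` scales this coordinate by `c⁻¹`.
  have hs : ∀ w, (T w).2.1 = c⁻¹ * w.2.1 := fun w => by
    have h := hT w nullInfinity
    rw [hc, map_smul, lorentz_nullInfinity, lorentz_nullInfinity, smul_eq_mul] at h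
    field_simp
    linarith
  have hs' : ∀ v : E, (T (nullLift v)).2.1 = c⁻¹ := fun v => by simp [hs, nullLift]
  let L₀ : E → E := fun v => c • (T (nullLift v)).1
  have hL₀ : ∀ v, T (nullLift v) = c⁻¹ • nullLift (L₀ v) := fun v => by
    have h := eq_smul_nullLift (hnull v) (by rw [hs']; exact inv_ne_zero hc0)
    rw [hs', inv_inv] at h
    exact h
  -- Products of null lifts are squared distances up to the factor `-1/2`, so preservation of the
  -- form is a statement about distances.
  have hdist : ∀ v w, ‖L₀ v - L₀ w‖ = |c| * ‖v - w‖ := fun v w => by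
    have h := hT (nullLift v) (nullLift w)
    rw [hL₀, hL₀, map_smul, LinearMap.map_smul₂, lorentz_nullLift, lorentz_nullLift, smul_eq_mul,
      smul_eq_mul] at h
    have h2 : ‖L₀ v - L₀ w‖ ^ 2 = (|c| * ‖v - w‖) ^ 2 := by
      rw [mul_pow, sq_abs]; field_simp at h; linarith
    exact (sq_eq_sq₀ (norm_nonneg _) (by positivity)).1 h2
  have hinj : Function.Injective L₀ := fun v w h => by
    have := hdist v w
    rw [h, sub_self, norm_zero] at this
    have := (mul_eq_zero.1 this.symm).resolve_left (abs_ne_zero.2 hc0)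
    exact sub_eq_zero.1 (norm_eq_zero.1 this)
  have hsurj : Function.Surjective L₀ := fun w => by
    have h1 : (S (nullLift w)).2.1 = c := by
      have := hs (S (nullLift w))
      rw [hTS] at this
      simp only [nullLift] at this ⊢
      field_simp at this
      exact this.symm
    have h2 : lorentz (S (nullLift w)) (S (nullLift w)) = 0 := by
      rw [← hT, hTS, lorentz_nullLift_self]
    have h3 := eq_smul_nullLift h2 (by rw [h1]; exact hc0)
    refine ⟨(S (nullLift w)).2.1⁻¹ • (S (nullLift w)).1,
      (nullLift_inj_of_smul (s := 1) (t := 1) one_ne_zero ?_).symm⟩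
    · have h4 := hTS (nullLift w)
      rw [h3, map_smul, hL₀, smul_smul, h1, mul_inv_cancel₀ hc0] at h4
      rw [h1]
      simpa using h4.symm
  refine ⟨{ toEquiv := Equiv.ofBijective L₀ ⟨hinj, hsurj⟩, edist_eq' := ?_ }, hL₀⟩
  refine ⟨⟨|c|, abs_nonneg c⟩, ?_, fun v w => ?_⟩
  · intro h
    exact hc0 (abs_eq_zero.1 (congrArg NNReal.toReal h))
  · change edist (L₀ v) (L₀ w) = _
    rw [edist_nndist, edist_nndist]
    refine (ENNReal.coe_inj.2 ?_).trans (ENNReal.coe_mul _ _)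
    refine NNReal.eq ((dist_eq_norm _ _).trans ((hdist v w).trans ?_))
    exact congrArg (|c| * ·) (dist_eq_norm v w).symm

end LightCone

/-- Maps whose null lifts differ by a Lorentzian involution are conformally congruent. -/
theorem conformallyCongruent_of_lorentz {X : Type*} {N : ℕ} {f f' : X → 𝔼 N}
    {T : (𝔼 N × ℝ × ℝ) →ₗ[ℝ] (𝔼 N × ℝ × ℝ)} (hT : ∀ v w, lorentz (T v) (T w) = lorentz v w)
    (hTT : ∀ v, T (T v) = v) {s : X → ℝ} (hs : ∀ x, s x ≠ 0)
    (h : ∀ x, T (nullLift (f x)) = s x • nullLift (f' x)) : ConformallyCongruent f f' := by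
  have hadj : ∀ v w, lorentz (T v) w = lorentz v (T w) := fun v w => by
    rw [← hT v, hTT]
  set q := T nullInfinity with hq
  have hnull : lorentz q q = 0 := by
    rw [hq, hT, lorentz_nullInfinity]; simp [nullInfinity]
  -- Either the point at infinity is fixed and `T` acts as a similarity, or it is sent to a finite
  -- point `a` and `T` is an inversion centred at `a` followed by a similarity.
  by_cases hα : q.2.1 = 0
  · have h1 : q.1 = 0 := by
      rw [lorentz_self, hα] at hnull; simpa using hnull
    obtain ⟨L, hL⟩ := exists_dilationEquiv_of_lorentz hT hTT hTT (c := q.2.2) (by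
      rw [← hq]
      refine Prod.ext ?_ (Prod.ext ?_ ?_) <;> simp [h1, hα, nullInfinity])
    refine Or.inl ⟨L, fun x => ?_⟩
    exact nullLift_inj_of_smul (hs x) (by rw [← h x]; exact hL (f x))
  · set a := q.2.1⁻¹ • q.1 with ha
    have hqa : q = q.2.1 • nullLift a := eq_smul_nullLift hnull hα
    -- The involution exchanges the lines of infinity and of `nullLift a`; a value `f x = a` would
    -- thus be sent to infinity, whereas its image is a nonzero multiple of the lift of a finite
    -- point.
    have hne : ∀ x, f x ≠ a := fun x hx => by
      have h2 := hadj (nullLift (f x)) nullInfinity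
      rw [h x, ← hq, hqa, hx, map_smul (lorentz _), lorentz_nullLift_self, smul_zero, LinearMap.map_smul₂, lorentz_nullInfinity] at h2
      simp [nullLift] at h2
      exact hs x h2
    have hTi : ∀ v, T (lorentzInversion a (lorentzInversion a (T v))) = v := fun v => by
      rw [lorentzInversion_lorentzInversion, hTT]
    -- The inversion sends infinity to `a` and `T` sends `a` back, so the composition falls under
    -- the similarity case.
    obtain ⟨L, hL⟩ := exists_dilationEquiv_of_lorentz (T := T ∘ₗ lorentzInversion a)
      (S := lorentzInversion a ∘ₗ T) (c := q.2.1⁻¹)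
      (fun v w => by simp only [LinearMap.comp_apply, hT, lorentz_lorentzInversion])
      hTi (fun v => by
        simp only [LinearMap.comp_apply, hTT, lorentzInversion_lorentzInversion])
      (by
        rw [LinearMap.comp_apply, lorentzInversion_nullInfinity]
        have h3 := congrArg T hqa
        rw [hq, hTT, map_smul, ← hq] at h3
        rw [h3, smul_smul, inv_mul_cancel₀ hα, one_smul])
    refine Or.inr ⟨L, a, 1, one_pos, hne, fun x => ?_⟩
    have h4 := hL (EuclideanGeometry.inversion a 1 (f x))
    have h5 := congrArg (lorentzInversion a) (lorentzInversion_nullLift (hne x))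
    rw [lorentzInversion_lorentzInversion, map_smul] at h5
    rw [LinearMap.comp_apply] at h4
    have h6 := h x
    rw [h5, map_smul, h4, smul_smul] at h6
    exact nullLift_inj_of_smul (hs x) h6.symm

/-! ### Differentials and integration of proportional differentials -/

section Calculus

variable {V : Type*} [NormedAddCommGroup V] [NormedSpace ℝ V]

/-- If the derivatives of two functions of at least two variables are proportional, the factor of
proportionality is stationary. -/
theorem hasFDerivAt_zero_of_fderiv_eq_smul {E : Type*} [NormedAddCommGroup E] [NormedSpace ℝ E]
    (hE : 1 < Module.finrank ℝ E) {U : Set E} (hU : IsOpen U) {k l : E → V} {c : E → ℝ}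
    (hk : ContDiffOn ℝ ∞ k U) (hl : ContDiffOn ℝ ∞ l U)
    (hinj : ∀ z ∈ U, Function.Injective (fderiv ℝ l z))
    (h : ∀ z ∈ U, fderiv ℝ k z = c z • fderiv ℝ l z) :
    ∀ z ∈ U, HasFDerivAt c (0 : E →L[ℝ] ℝ) z := by
  intro z hz
  have hUz : U ∈ nhds z := hU.mem_nhds hz
  have hk2 : ContDiffAt ℝ ∞ k z := hk.contDiffAt hUz
  have hl2 : ContDiffAt ℝ ∞ l z := hl.contDiffAt hUz
  have hdk : DifferentiableAt ℝ (fderiv ℝ k) z :=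
    (hk2.fderiv_right (m := 1) (WithTop.coe_le_coe.2 le_top)).differentiableAt one_ne_zero
  have hdl : DifferentiableAt ℝ (fderiv ℝ l) z :=
    (hl2.fderiv_right (m := 1) (WithTop.coe_le_coe.2 le_top)).differentiableAt one_ne_zero
  have hnt : Nontrivial E := Module.nontrivial_of_finrank_pos (R := ℝ) (by omega)
  -- No regularity of `c` is given: locally it is the quotient of `η (dk v)` by `η (dl v)`, for a
  -- functional `η` that does not vanish on `dl v`.
  have hc : DifferentiableAt ℝ c z := by
    obtain ⟨v, hv⟩ := exists_ne (0 : E)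
    have hv0 : fderiv ℝ l z v ≠ 0 := fun h0 => hv (hinj z hz (by rw [h0, map_zero]))
    obtain ⟨η, hη⟩ := SeparatingDual.exists_ne_zero (R := ℝ) hv0
    have h1 : DifferentiableAt ℝ (fun y => η (fderiv ℝ l y v)) z := by fun_prop
    have h2 : DifferentiableAt ℝ (fun y => η (fderiv ℝ k y v)) z := by fun_prop
    refine (h2.mul (h1.inv hη)).congr_of_eventuallyEq ?_
    filter_upwards [hUz, h1.continuousAt.eventually_ne hη] with y hy hy0
    simp [h y hy, hy0]
  have hsymk : ∀ u v, fderiv ℝ (fderiv ℝ k) z u v = fderiv ℝ (fderiv ℝ k) z v u :=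
    (hk2.isSymmSndFDerivAt 
      (by simpa using WithTop.coe_le_coe.2 (le_top (a := (2 : ℕ∞))))).eq
  have hsyml : ∀ u v, fderiv ℝ (fderiv ℝ l) z u v = fderiv ℝ (fderiv ℝ l) z v u :=
    (hl2.isSymmSndFDerivAt 
      (by simpa using WithTop.coe_le_coe.2 (le_top (a := (2 : ℕ∞))))).eq
  have hD : fderiv ℝ (fderiv ℝ k) z =
      c z • fderiv ℝ (fderiv ℝ l) z + (fderiv ℝ c z).smulRight (fderiv ℝ l z) := by
    refine HasFDerivAt.fderiv ?_
    refine (hc.hasFDerivAt.smul hdl.hasFDerivAt).congr_of_eventuallyEq ?_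
    filter_upwards [hUz] with y hy using h y hy
  -- Symmetry of both second derivatives leaves `dc(u) dl(v) = dc(v) dl(u)`. For independent `u` and
  -- `v`, injectivity of `dl` forces `dc(u) = 0`; dimension at least two is essential here.
  have hc0 : fderiv ℝ c z = 0 := by
    ext u
    rcases eq_or_ne u 0 with rfl | hu
    · simp
    obtain ⟨v, hv⟩ := exists_linearIndependent_pair_of_one_lt_finrank hE hu
    have h3 := hsymk u v
    simp only [hD, add_apply, smul_apply,
      ContinuousLinearMap.smulRight_apply, hsyml u v, add_right_inj] at h3
    have h4 : fderiv ℝ l z (fderiv ℝ c z v • u + (-fderiv ℝ c z u) • v) = fderiv ℝ l z 0 := by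
      rw [map_add, map_smul, map_smul, map_zero, neg_smul, h3, add_neg_cancel]
    have h5 := (LinearIndependent.pair_iff.1 hv _ _ (hinj z hz h4)).2
    simpa using h5
  rw [← hc0]
  exact hc.hasFDerivAt

variable {n : ℕ} {M : Type*} [TopologicalSpace M] [ChartedSpace (𝔼 n) M]

theorem contDiffOn_comp_chartAt_symm [IsManifold (𝓡 n) ∞ M] {k : M → V} (hk : ContMDiff (𝓡 n) 𝓘(ℝ, V) ∞ k) (p : M) :
    ContDiffOn ℝ ∞ (k ∘ (chartAt (𝔼 n) p).symm) (chartAt (𝔼 n) p).target := by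
  rw [← contMDiffOn_iff_contDiffOn]
  exact hk.comp_contMDiffOn (contMDiffOn_chart_symm (n := ∞) (x := p))

variable (n) in
/-- The differential of a map with values in a vector space. -/
def vectorDifferential (k : M → V) (p : M) : 𝔼 n →L[ℝ] V := mfderiv (𝓡 n) 𝓘(ℝ, V) k p

variable (n) in
/-- `k'` is the differential of `k` at `p`. -/
def HasDifferentialAt (k : M → V) (k' : 𝔼 n →L[ℝ] V) (p : M) : Prop :=
  HasMFDerivAt (𝓡 n) 𝓘(ℝ, V) k p k'

theorem hasDifferentialAt_iff {k : M → V} {k' : 𝔼 n →L[ℝ] V} {p : M} :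
    HasDifferentialAt n k k' p ↔ ContinuousAt k p ∧
      HasFDerivAt (k ∘ (chartAt (𝔼 n) p).symm) k' (chartAt (𝔼 n) p p) := by
  refine and_congr_right fun _ => ?_
  have h1 : writtenInExtChartAt (𝓡 n) 𝓘(ℝ, V) p k = k ∘ (chartAt (𝔼 n) p).symm := rfl
  have h2 : extChartAt (𝓡 n) p p = chartAt (𝔼 n) p p := by simp [mfld_simps]
  rw [h1, h2, modelWithCornersSelf_coe, Set.range_id]
  exact hasFDerivWithinAt_univ

theorem _root_.MDifferentiableAt.hasDifferentialAt {k : M → V} {p : M}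
    (hk : MDifferentiableAt (𝓡 n) 𝓘(ℝ, V) k p) :
    HasDifferentialAt n k (vectorDifferential n k p) p := hk.hasMFDerivAt

namespace HasDifferentialAt

variable {k l : M → V} {k' l' : 𝔼 n →L[ℝ] V} {p : M}

theorem mdifferentiableAt (hk : HasDifferentialAt n k k' p) :
    MDifferentiableAt (𝓡 n) 𝓘(ℝ, V) k p := HasMFDerivAt.mdifferentiableAt hk

theorem eq (hk : HasDifferentialAt n k k' p) : vectorDifferential n k p = k' :=
  HasMFDerivAt.mfderiv hk

theorem unique (hk : HasDifferentialAt n k k' p) (hk₂ : HasDifferentialAt n k l' p) : k' = l' :=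
  hk.eq.symm.trans hk₂.eq

theorem const (v : V) (p : M) : HasDifferentialAt n (fun _ : M => v) 0 p :=
  hasMFDerivAt_const v p

theorem comp {W : Type*} [NormedAddCommGroup W] [NormedSpace ℝ W] {F : V → W} {F' : V →L[ℝ] W}
    (hF : HasFDerivAt F F' (k p)) (hk : HasDifferentialAt n k k' p) :
    HasDifferentialAt n (fun q => F (k q)) (F'.comp k') p := by
  rw [hasDifferentialAt_iff] at hk ⊢
  refine ⟨hF.continuousAt.comp hk.1, HasFDerivAt.comp _ ?_ hk.2⟩
  rwa [Function.comp_apply, (chartAt (𝔼 n) p).left_inv (mem_chart_source _ p)]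

theorem prodMk {W : Type*} [NormedAddCommGroup W] [NormedSpace ℝ W] {m : M → W}
    {m' : 𝔼 n →L[ℝ] W} (hk : HasDifferentialAt n k k' p) (hm : HasDifferentialAt n m m' p) :
    HasDifferentialAt n (fun q => (k q, m q)) (k'.prod m') p := by
  rw [hasDifferentialAt_iff] at hk hm ⊢
  exact ⟨hk.1.prodMk hm.1, hk.2.prodMk hm.2⟩

theorem add (hk : HasDifferentialAt n k k' p) (hl : HasDifferentialAt n l l' p) :
    HasDifferentialAt n (fun q => k q + l q) (k' + l') p := by
  rw [hasDifferentialAt_iff] at hk hl ⊢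
  exact ⟨hk.1.add hl.1, hk.2.add hl.2⟩

theorem sub (hk : HasDifferentialAt n k k' p) (hl : HasDifferentialAt n l l' p) :
    HasDifferentialAt n (fun q => k q - l q) (k' - l') p := by
  rw [hasDifferentialAt_iff] at hk hl ⊢
  exact ⟨hk.1.sub hl.1, hk.2.sub hl.2⟩

theorem smul {s : M → ℝ} {s' : 𝔼 n →L[ℝ] ℝ} (hs : HasDifferentialAt n s s' p)
    (hk : HasDifferentialAt n k k' p) :
    HasDifferentialAt n (fun q => s q • k q) (s p • k' + s'.smulRight (k p)) p := by
  rw [hasDifferentialAt_iff] at hs hk ⊢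
  refine ⟨hs.1.smul hk.1, ?_⟩
  have h := hs.2.smul hk.2
  simp only [Function.comp_apply, (chartAt (𝔼 n) p).left_inv (mem_chart_source _ p)] at h
  exact h

end HasDifferentialAt

/-- The differential of the inverse of the chart at `p`. -/
def chartSymmDeriv (n : ℕ) {M : Type*} [TopologicalSpace M] [ChartedSpace (𝔼 n) M] (p : M)
    (z : 𝔼 n) : 𝔼 n →L[ℝ] 𝔼 n :=
  mfderiv (𝓡 n) (𝓡 n) (chartAt (𝔼 n) p).symm z

theorem hasFDerivAt_comp_chartAt_symm [IsManifold (𝓡 n) ∞ M] {k : M → V} (p : M) {z : 𝔼 n} {k' : 𝔼 n →L[ℝ] V}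
    (hz : z ∈ (chartAt (𝔼 n) p).target)
    (hk : HasMFDerivAt (𝓡 n) 𝓘(ℝ, V) k ((chartAt (𝔼 n) p).symm z) k') :
    HasFDerivAt (k ∘ (chartAt (𝔼 n) p).symm) (k'.comp (chartSymmDeriv n p z)) z := by
  have : IsManifold (𝓡 n) 1 M := IsManifold.of_le (n := ∞) (WithTop.coe_le_coe.2 le_top)
  refine HasMFDerivAt.hasFDerivAt (?_ : HasMFDerivAt (𝓡 n) 𝓘(ℝ, V) _ z _)
  exact hk.comp z
    ((mdifferentiable_chart (I := 𝓡 n) p).mdifferentiableAt_symm hz).hasMFDerivAt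

theorem chartSymmDeriv_bijective [IsManifold (𝓡 n) ∞ M] (p : M) {z : 𝔼 n} (hz : z ∈ (chartAt (𝔼 n) p).target) :
    Function.Bijective (chartSymmDeriv n p z) := by
  have : IsManifold (𝓡 n) 1 M := IsManifold.of_le (n := ∞) (WithTop.coe_le_coe.2 le_top)
  exact (mdifferentiable_chart (I := 𝓡 n) p).symm.mfderiv_bijective hz

theorem isLocallyConstant_of_chartAt {k : M → V}
    (hk : ∀ p : M, ∀ z ∈ (chartAt (𝔼 n) p).target,
      HasFDerivAt (k ∘ (chartAt (𝔼 n) p).symm) (0 : 𝔼 n →L[ℝ] V) z) : IsLocallyConstant k := by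
  rw [IsLocallyConstant.iff_eventually_eq]
  intro p
  set e := chartAt (𝔼 n) p
  obtain ⟨ε, hε, hball⟩ := Metric.isOpen_iff.1 e.open_target (e p) (mem_chart_target _ p)
  have hev : ∀ᶠ q in nhds p, q ∈ e.source ∧ e q ∈ Metric.ball (e p) ε :=
    Filter.Eventually.and (e.open_source.mem_nhds (mem_chart_source _ p))
      ((e.continuousAt (mem_chart_source _ p)).eventually (Metric.ball_mem_nhds _ hε))
  filter_upwards [hev] with q hq
  have h := Metric.isOpen_ball.is_const_of_fderiv_eq_zero (𝕜 := ℝ)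
    (convex_ball (e p) ε).isPreconnected
    (fun z hz => (hk p z (hball hz)).differentiableAt.differentiableWithinAt)
    (fun z hz => (hk p z (hball hz)).fderiv) hq.2 (Metric.mem_ball_self hε)
  change k (e.symm (e q)) = k (e.symm (e p)) at h
  rwa [e.left_inv hq.1, e.left_inv (mem_chart_source _ p)] at h

theorem eq_of_vectorDifferential_eq_zero [IsManifold (𝓡 n) ∞ M] [PreconnectedSpace M] {k : M → V}
    (hk : ∀ p, HasDifferentialAt n k 0 p) (p q : M) : k p = k q := by
  refine (isLocallyConstant_of_chartAt (n := n) fun p z hz => ?_).apply_eq_of_preconnectedSpace p q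
  exact hasFDerivAt_comp_chartAt_symm p hz (hk _)

/-- If the differential of a function is a multiple of the differential of an immersion of a
connected manifold of dimension at least two, the function is affine in the immersion. -/
theorem exists_eq_smul_add_of_vectorDifferential_eq_smul [IsManifold (𝓡 n) ∞ M] [ConnectedSpace M]
    (hn : 1 < n) {k l : M → V} {c : M → ℝ} (hk : ContMDiff (𝓡 n) 𝓘(ℝ, V) ∞ k)
    (hl : ContMDiff (𝓡 n) 𝓘(ℝ, V) ∞ l)
    (hinj : ∀ p, Function.Injective (vectorDifferential n l p))
    (h : ∀ p, vectorDifferential n k p = c p • vectorDifferential n l p) :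
    ∃ (c₀ : ℝ) (a : V), ∀ p, c p = c₀ ∧ k p = c₀ • l p + a := by
  obtain ⟨p₀⟩ : Nonempty M := inferInstance
  have hkd := fun p => ((hk.mdifferentiable (by simp)) p).hasDifferentialAt
  have hld := fun p => ((hl.mdifferentiable (by simp)) p).hasDifferentialAt
  have hc : ∀ p, c p = c p₀ := fun p => by
    refine (isLocallyConstant_of_chartAt (n := n) fun q z hz => ?_).apply_eq_of_preconnectedSpace p p₀
    refine hasFDerivAt_zero_of_fderiv_eq_smul (by simpa using hn) (chartAt (𝔼 n) q).open_target
      (contDiffOn_comp_chartAt_symm hk q) (contDiffOn_comp_chartAt_symm hl q)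
      (fun y hy => ?_) (fun y hy => ?_) z hz
    · rw [(hasFDerivAt_comp_chartAt_symm q hy (hld _)).fderiv]
      exact (hinj _).comp (chartSymmDeriv_bijective q hy).1
    · rw [(hasFDerivAt_comp_chartAt_symm q hy (hld _)).fderiv,
        (hasFDerivAt_comp_chartAt_symm q hy (hkd _)).fderiv, h]
      rfl
  refine ⟨c p₀, k p₀ - c p₀ • l p₀, fun p => ⟨hc p, ?_⟩⟩
  have hd : ∀ p, HasDifferentialAt n (fun q => k q - c p₀ • l q) 0 p := fun p => by
    have h1 := (hkd p).sub ((HasDifferentialAt.const (c p₀) p).smul (hld p))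
    rw [h, hc p] at h1
    convert h1 using 1
    ext X
    simp
  rw [← eq_of_vectorDifferential_eq_zero hd p p₀]
  abel

end Calculus

/-! ### Lifts of a Ribaucour transform -/

section Lifts

variable {E : Type*} [NormedAddCommGroup E] [InnerProductSpace ℝ E]
  {n : ℕ} {M : Type*} [TopologicalSpace M] [ChartedSpace (𝔼 n) M]

/-- The vector `G` of the light cone model such that the reflection in `G` maps `nullLift h` to the
null lift of the Ribaucour transform of `h` with field `F` and function `φ`. -/
def sphereLift (F h : E) (φ : ℝ) : E × ℝ × ℝ := (F, 0, 2 * (inner ℝ F h - φ))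

theorem vectorDifferential_nullLift {h : M → E} {h' : 𝔼 n →L[ℝ] E} {p : M}
    (hh : HasDifferentialAt n h h' p) (X : 𝔼 n) :
    vectorDifferential n (fun q => nullLift (h q)) p X = (h' X, 0, 2 * inner ℝ (h p) (h' X)) := by
  have h1 := hh.comp (F := fun v => nullLift v) ((hasFDerivAt_id (h p)).prodMk
    ((hasFDerivAt_const (1 : ℝ) (h p)).prodMk (hasFDerivAt_id (h p)).norm_sq))
  rw [h1.eq]
  refine Prod.ext rfl (Prod.ext rfl ?_)
  change 2 • inner ℝ (h p) (h' X) = _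
  rw [two_smul, two_mul]

theorem vectorDifferential_sphereLift {F h : M → E} {φ : M → ℝ} {F' h' : 𝔼 n →L[ℝ] E}
    {φ' : 𝔼 n →L[ℝ] ℝ} {p : M} (hF : HasDifferentialAt n F F' p)
    (hh : HasDifferentialAt n h h' p) (hφ : HasDifferentialAt n φ φ' p) (X : 𝔼 n) :
    vectorDifferential n (fun q => sphereLift (F q) (h q) (φ q)) p X =
      (F' X, 0, 2 * (inner ℝ (F p) (h' X) + inner ℝ (F' X) (h p) - φ' X)) := by
  have hv := hF.prodMk (hh.prodMk hφ)
  have hid := hasFDerivAt_id (𝕜 := ℝ) (F p, h p, φ p)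
  have h1 := HasDifferentialAt.comp (k := fun q => (F q, h q, φ q))
    (F := fun v : E × E × ℝ => sphereLift v.1 v.2.1 v.2.2)
    (hid.fst.prodMk ((hasFDerivAt_const (0 : ℝ) _).prodMk
      (((hid.fst.inner ℝ hid.snd.fst).sub hid.snd.snd).const_mul 2))) hv
  rw [h1.eq]
  rfl

/-- This is the reflection of `nullLift h` in `G = sphereLift F h φ`, cleared of its denominator:
`⟨nullLift h, G⟩ = φ` and `⟨G, G⟩ = ‖F‖²`. -/
theorem smul_nullLift_ribaucour {F h : E} {φ : ℝ} (hF : F ≠ 0) (hφ : φ ≠ 0) :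
    (‖F‖ ^ 2 / φ) • nullLift (h - (2 * (inner ℝ F F)⁻¹ * φ) • F) =
      (‖F‖ ^ 2 / φ) • nullLift h - (2 : ℝ) • sphereLift F h φ := by
  have h0 : ‖F‖ ≠ 0 := norm_ne_zero_iff.2 hF
  rw [real_inner_self_eq_norm_sq]
  refine Prod.ext ?_ (Prod.ext ?_ ?_)
  · simp only [nullLift, sphereLift, Prod.smul_fst, Prod.fst_sub, smul_sub, smul_smul]
    congr 2
    field_simp
  · simp [nullLift, sphereLift]
  · simp only [nullLift, sphereLift, Prod.smul_snd, Prod.snd_sub, norm_sub_sq_real, norm_smul,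
      inner_smul_right, smul_eq_mul, mul_pow, Real.norm_eq_abs, sq_abs, real_inner_comm F h]
    field_simp
    ring

theorem contDiff_nullLift : ContDiff ℝ ∞ (nullLift : E → E × ℝ × ℝ) :=
  contDiff_id.prodMk (contDiff_const.prodMk (contDiff_id.norm_sq ℝ))

theorem contDiff_sphereLift :
    ContDiff ℝ ∞ (fun v : E × E × ℝ => sphereLift v.1 v.2.1 v.2.2) := by
  unfold sphereLift
  have h1 : ContDiff ℝ ∞ (fun v : E × E × ℝ => inner ℝ v.1 v.2.1) :=
    contDiff_fst.inner ℝ (contDiff_fst.comp contDiff_snd)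
  exact contDiff_fst.prodMk (contDiff_const.prodMk
    (contDiff_const.mul (h1.sub (contDiff_snd.comp contDiff_snd))))

/-- Because `dφ = ⟨F, dh⟩`, two terms of the last coordinate of `dG` cancel and `dG = c d(nullLift
h)` remains. The lift of an immersion is an immersion, so this integrates with constant factor. -/
theorem exists_sphereLift_eq_smul_add [IsManifold (𝓡 n) ∞ M] [ConnectedSpace M] (hn : 1 < n)
    {h F : M → E} {φ c : M → ℝ} (hh : ContMDiff (𝓡 n) 𝓘(ℝ, E) ∞ h)
    (hF : ContMDiff (𝓡 n) 𝓘(ℝ, E) ∞ F) (hφ : ContMDiff (𝓡 n) 𝓘(ℝ, ℝ) ∞ φ)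
    (hinj : ∀ p X, vectorDifferential n h p X = 0 → X = 0)
    (hFh : ∀ p, vectorDifferential n F p = c p • vectorDifferential n h p)
    (hφh : ∀ p X, vectorDifferential n φ p X = inner ℝ (F p) (vectorDifferential n h p X)) :
    ∃ (c₀ : ℝ) (a : E × ℝ × ℝ), ∀ p, c p = c₀ ∧
      sphereLift (F p) (h p) (φ p) = c₀ • nullLift (h p) + a := by
  have hd := fun p => (hh.mdifferentiable (by simp) p).hasDifferentialAt
  have hFd := fun p => (hF.mdifferentiable (by simp) p).hasDifferentialAt
  have hφd := fun p => (hφ.mdifferentiable (by simp) p).hasDifferentialAt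
  refine exists_eq_smul_add_of_vectorDifferential_eq_smul hn
    (k := fun p => sphereLift (F p) (h p) (φ p)) (l := fun p => nullLift (h p))
    (contDiff_sphereLift.contMDiff.comp (hF.prodMk_space (hh.prodMk_space hφ)))
    (contDiff_nullLift.contMDiff.comp hh) (fun p => ?_) (fun p => ?_)
  · refine (injective_iff_map_eq_zero _).2 fun X hX => hinj p X ?_
    exact congrArg Prod.fst ((vectorDifferential_nullLift (hd p) X).symm.trans hX)
  · ext1 X
    rw [smul_apply, vectorDifferential_sphereLift (hFd p) (hd p) (hφd p),
      vectorDifferential_nullLift (hd p), hφh, hFh, add_sub_cancel_left, smul_apply,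
      real_inner_comm (h p), inner_smul_right]
    refine Prod.ext rfl (Prod.ext (mul_zero _).symm ?_)
    simp only [Prod.smul_snd, smul_eq_mul]
    ring

theorem _root_.MDifferentiableAt.inv_real {φ : M → ℝ} {p : M}
    (hφ : MDifferentiableAt (𝓡 n) 𝓘(ℝ, ℝ) φ p) (h0 : φ p ≠ 0) :
    MDifferentiableAt (𝓡 n) 𝓘(ℝ, ℝ) (fun q => (φ q)⁻¹) p :=
  (HasDifferentialAt.comp (hasDerivAt_inv h0).hasFDerivAt hφ.hasDifferentialAt).mdifferentiableAt

theorem _root_.MDifferentiableAt.norm_sq_div {F : M → E} {φ : M → ℝ} {p : M}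
    (hF : MDifferentiableAt (𝓡 n) 𝓘(ℝ, E) F p) (hφ : MDifferentiableAt (𝓡 n) 𝓘(ℝ, ℝ) φ p)
    (h0 : φ p ≠ 0) : MDifferentiableAt (𝓡 n) 𝓘(ℝ, ℝ) (fun q => ‖F q‖ ^ 2 / φ q) p := by
  have h1 := HasDifferentialAt.comp (F := fun v : E => ‖v‖ ^ 2) (hasFDerivAt_id (F p)).norm_sq
    hF.hasDifferentialAt
  exact (h1.smul (hφ.inv_real h0).hasDifferentialAt).mdifferentiableAt

/-- If `nullLift h` is proportional to `k`, the differential of `k` determines that of `h` modulo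
multiples of `k`. -/
theorem exists_vectorDifferential_eq_of_nullLift_eq_smul {h : M → E} {k : M → E × ℝ × ℝ}
    {σ : M → ℝ} {p : M} (hh : MDifferentiableAt (𝓡 n) 𝓘(ℝ, E) h p)
    (hk : MDifferentiableAt (𝓡 n) 𝓘(ℝ, E × ℝ × ℝ) k p)
    (hσ : MDifferentiableAt (𝓡 n) 𝓘(ℝ, ℝ) σ p) (hlift : ∀ q, nullLift (h q) = σ q • k q)
    (X : 𝔼 n) : ∃ c t : ℝ, ((vectorDifferential n h p X, 0, t) : E × ℝ × ℝ) =
      σ p • vectorDifferential n k p X + c • k p := by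
  have h1 := hσ.hasDifferentialAt.smul hk.hasDifferentialAt
  simp only [← hlift] at h1
  exact ⟨_, _, (vectorDifferential_nullLift hh.hasDifferentialAt X).symm.trans
    (congrArg (fun A : 𝔼 n →L[ℝ] E × ℝ × ℝ => A X) h1.eq)⟩

end Lifts

/-- Maps with null lifts proportional to `P + Q` and `Q - P`, where `P` and `Q` depend on different
variables, are conformally congruent. -/
theorem conformallyCongruent_of_lift_eq_add {X Y : Type*} [Nonempty X] [Nonempty Y] {N : ℕ}
    {h h' : X × Y → 𝔼 N} {P : X → 𝔼 N × ℝ × ℝ} {Q : Y → 𝔼 N × ℝ × ℝ} {s t : X × Y → ℝ}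
    (hs : ∀ p, s p • nullLift (h p) = P p.1 + Q p.2) (hs0 : ∀ p, s p ≠ 0)
    (ht : ∀ p, t p • nullLift (h' p) = Q p.2 - P p.1) (ht0 : ∀ p, t p ≠ 0)
    (hX : ∀ y, ∃ x x', h (x, y) ≠ h (x', y)) (hY : ∀ x, ∃ y y', h (x, y) ≠ h (x, y')) :
    ConformallyCongruent h h' := by
  have h1 : ∀ x y, lorentz (P x + Q y) (P x + Q y) = 0 := fun x y => by
    rw [← hs (x, y), map_smul, LinearMap.map_smul₂, lorentz_nullLift_self, smul_zero, smul_zero]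
  have h2 : ∀ x y, lorentz (Q y - P x) (Q y - P x) = 0 := fun x y => by
    rw [← ht (x, y), map_smul, LinearMap.map_smul₂, lorentz_nullLift_self, smul_zero, smul_zero]
  -- Comparing the squares of `P + Q` and `Q - P` gives orthogonality, and then the sum of the
  -- squares of `P` and `Q` is zero.
  simp only [map_add, map_sub, LinearMap.add_apply, LinearMap.sub_apply] at h1 h2
  have hPQ : ∀ x y, lorentz (P x) (Q y) = 0 := fun x y => by
    have := h1 x y; have := h2 x y; have := lorentz_comm (P x) (Q y); linarith
  have hQP : ∀ y x, lorentz (Q y) (P x) = 0 := fun y x => by rw [lorentz_comm]; exact hPQ x y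
  have hsum : ∀ x y, lorentz (P x) (P x) + lorentz (Q y) (Q y) = 0 := fun x y => by
    have := h1 x y; have := hPQ x y; have := hQP y x; linarith
  obtain ⟨x₀⟩ := ‹Nonempty X›
  obtain ⟨y₀⟩ := ‹Nonempty Y›
  -- The sign `ε` covers both reflections: the one fixing `Q` and the one fixing `P`.
  have key : ∀ (T : (𝔼 N × ℝ × ℝ) →ₗ[ℝ] (𝔼 N × ℝ × ℝ)) (ε : ℝ), ε ≠ 0 →
      (∀ v w, lorentz (T v) (T w) = lorentz v w) → (∀ v, T (T v) = v) →
      (∀ x, T (P x) = -ε • P x) → (∀ y, T (Q y) = ε • Q y) → ConformallyCongruent h h' := by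
    intro T ε hε hT hTT hTP hTQ
    refine conformallyCongruent_of_lorentz hT hTT (s := fun p => (s p)⁻¹ * (ε * t p))
      (fun p => mul_ne_zero (inv_ne_zero (hs0 p)) (mul_ne_zero hε (ht0 p))) fun p => ?_
    have h3 : nullLift (h p) = (s p)⁻¹ • (P p.1 + Q p.2) := by
      rw [← hs, smul_smul, inv_mul_cancel₀ (hs0 p), one_smul]
    rw [h3, map_smul, map_add, hTP, hTQ, mul_smul, mul_smul, ht]
    module
  rcases lt_trichotomy (lorentz (P x₀) (P x₀)) 0 with hneg | h0 | hpos
  · have hP : ∀ x, lorentz (P x) (P x) < 0 := fun x => by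
      have := hsum x y₀; have := hsum x₀ y₀; linarith
    have : Nonempty X := ⟨x₀⟩
    obtain ⟨T, hT, hTT, hTP, hTQ⟩ := exists_lorentz_reflection hP hPQ
    exact key T 1 one_ne_zero hT hTT (fun x => by rw [hTP, neg_one_smul])
      (fun y => by rw [hTQ, one_smul])
  -- In the lightlike case all vectors in sight are null. If `Q` vanishes identically, `h` does not
  -- depend on `y`; otherwise the lifts at `(x, y)` and `(x', y)` are orthogonal, so the points
  -- coincide.
  · exfalso
    have hQ0 : ∀ y, lorentz (Q y) (Q y) = 0 := fun y => by have := hsum x₀ y; linarith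
    have hP0 : ∀ x, lorentz (P x) (P x) = 0 := fun x => by
      have := hsum x y₀; have := hQ0 y₀; linarith
    by_cases hQ : ∀ y, Q y = 0
    · obtain ⟨y, y', hne⟩ := hY x₀
      refine hne (nullLift_inj_of_smul (hs0 (x₀, y)) (t := s (x₀, y')) ?_)
      rw [hs, hs, hQ, hQ]
    · push Not at hQ
      obtain ⟨y, hy⟩ := hQ
      obtain ⟨x, x', hne⟩ := hX y
      have h3 := lorentz_eq_zero_of_null (hQ0 y) hy (hP0 x) (hP0 x') (hQP y x) (hQP y x')
      have h4 : lorentz (P x + Q y) (P x' + Q y) = 0 := by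
        simp only [map_add, LinearMap.add_apply, h3, hPQ, hQP, hQ0, add_zero]
      rw [← hs (x, y), ← hs (x', y), map_smul, LinearMap.map_smul₂, lorentz_nullLift, smul_eq_mul,
        smul_eq_mul] at h4
      have h5 := (mul_eq_zero.1 ((mul_eq_zero.1 h4).resolve_left (hs0 _))).resolve_left (hs0 _)
      have h6 : ‖h (x, y) - h (x', y)‖ = 0 := by
        have : ‖h (x, y) - h (x', y)‖ ^ 2 = 0 := by linarith
        simpa using this
      exact hne (sub_eq_zero.1 (norm_eq_zero.1 h6))
  · have hQ : ∀ y, lorentz (Q y) (Q y) < 0 := fun y => by have := hsum x₀ y; linarith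
    have : Nonempty Y := ⟨y₀⟩
    obtain ⟨T, hT, hTT, hTQ, hTP⟩ := exists_lorentz_reflection hQ hQP
    exact key T (-1) (by norm_num) hT hTT (fun x => by rw [hTP, neg_neg, one_smul])
      (fun y => by rw [hTQ, neg_one_smul])

/-! ### Comparison of two additive splittings -/

section Products

variable {n₁ n₂ : ℕ}
  {M₁ : Type*} [TopologicalSpace M₁] [ChartedSpace (𝔼 n₁) M₁]
  {M₂ : Type*} [TopologicalSpace M₂] [ChartedSpace (𝔼 n₂) M₂]

/-- If `u (P + Q)` is again a sum of functions of the two variables, then `u` is stationary,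
provided that `P` and `Q` are in general position. -/
theorem smul_eq_zero_of_smul_add_eq {V : Type*} [NormedAddCommGroup V] [NormedSpace ℝ V]
    {P b : M₁ → V} {Q a : M₂ → V} {u : M₁ → M₂ → ℝ} (ζ : V →L[ℝ] ℝ)
    (hP : MDifferentiable (𝓡 n₁) 𝓘(ℝ, V) P) (hQ : MDifferentiable (𝓡 n₂) 𝓘(ℝ, V) Q)
    (hu₁ : ∀ y, MDifferentiable (𝓡 n₁) 𝓘(ℝ, ℝ) fun x => u x y)
    (hu₂ : ∀ x, MDifferentiable (𝓡 n₂) 𝓘(ℝ, ℝ) fun y => u x y)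
    (hζ : ∀ x y, ζ (P x + Q y) ≠ 0) (h : ∀ x y, u x y • (P x + Q y) = b x - a y)
    (hind : ∀ (x : M₁) (y : M₂) (X : 𝔼 n₁) (Y : 𝔼 n₂) (c : ℝ),
      c • (P x + Q y) + (vectorDifferential n₁ P x X + vectorDifferential n₂ Q y Y) = 0 →
        X = 0 ∧ Y = 0)
    (x : M₁) (y : M₂) (X : 𝔼 n₁) (Y : 𝔼 n₂) :
    vectorDifferential n₂ (fun y => u x y) y Y • X = 0 ∧
      vectorDifferential n₁ (fun x => u x y) x X • Y = 0 := by
  set dP := vectorDifferential n₁ P x X with hdP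
  set α : M₂ → ℝ := fun y' => vectorDifferential n₁ (fun x => u x y') x X with hα
  have hderiv : ∀ y', HasDifferentialAt n₁ b (u x y' • vectorDifferential n₁ P x +
      (vectorDifferential n₁ (fun x => u x y') x).smulRight (P x + Q y')) x := fun y' => by
    have h1 := ((hu₁ y' x).hasDifferentialAt.smul
      ((hP x).hasDifferentialAt.add (HasDifferentialAt.const (Q y') x))).add
      (HasDifferentialAt.const (a y') x)
    convert h1 using 1
    · ext1 q
      rw [h, sub_add_cancel]
    · simp
  -- Differentiation of `u (P + Q) = b - a` in `x` gives the derivative of `b`, which does not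
  -- involve `y`.
  have hrel : ∀ y', u x y' • dP + α y' • (P x + Q y') = u x y • dP + α y • (P x + Q y) :=
    fun y' => congrArg (fun A : 𝔼 n₁ →L[ℝ] V => A X) ((hderiv y').unique (hderiv y))
  set B : V := u x y • dP + α y • (P x + Q y) with hB
  have hθd := (HasDifferentialAt.const (n := n₂) (P x) y).add (hQ y).hasDifferentialAt
  have hud := (hu₂ x y).hasDifferentialAt
  -- Only separate differentiability of `u` is available, so that of `α` in `y` is read off by
  -- applying `ζ` to `hrel` and solving for `α`.
  have hαd : ∃ α', HasDifferentialAt n₂ α α' y := by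
    have h1 := ((HasDifferentialAt.const (n := n₂) (ζ B) y).sub
      (hud.smul (HasDifferentialAt.const (ζ dP) y))).prodMk (hθd.comp ζ.hasFDerivAt)
    have hdiv : DifferentiableAt ℝ (fun v : ℝ × ℝ => v.1 * v.2⁻¹)
        (ζ B - u x y • ζ dP, ζ (P x + Q y)) :=
      differentiableAt_fst.mul (DifferentiableAt.inv differentiableAt_snd (by exact hζ x y))
    have hαe : α = fun q => (ζ B - u x q • ζ dP) * (ζ (P x + Q q))⁻¹ := by
      ext1 y'
      rw [← div_eq_mul_inv, eq_div_iff (hζ x y'), ← hrel y', map_add ζ (_ • _), map_smul, map_smul,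
        add_sub_cancel_left, smul_eq_mul]
    rw [hαe]
    exact ⟨_, HasDifferentialAt.comp
      (k := fun q => (ζ B - u x q • ζ dP, ζ (P x + Q q))) hdiv.hasFDerivAt h1⟩
  obtain ⟨α', hα'⟩ := hαd
  have hD := (hud.smul (HasDifferentialAt.const dP y)).add (hα'.smul hθd)
  have hD0 : HasDifferentialAt n₂ (fun q => u x q • dP + α q • (P x + Q q)) 0 y := by
    simp only [hrel]
    exact HasDifferentialAt.const B y
  have hz := congrArg (fun A : 𝔼 n₂ →L[ℝ] V => A Y) (hD.unique hD0)
  simp only [smul_zero, zero_add, add_apply, smul_apply, ContinuousLinearMap.smulRight_apply,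
    zero_apply] at hz
  -- The `y`-derivative of `hrel` is a relation among `P + Q`, `dP` and `dQ`; general position makes
  -- its `dP` and `dQ` arguments vanish.
  refine hind x y _ _ (α' Y) ?_
  rw [map_smul, map_smul, ← hz]
  abel

theorem exists_eq_const_of_smul_add_eq [IsManifold (𝓡 n₁) ∞ M₁] [ConnectedSpace M₁]
    [IsManifold (𝓡 n₂) ∞ M₂] [ConnectedSpace M₂] (h₁ : 0 < n₁) (h₂ : 0 < n₂)
    {V : Type*} [NormedAddCommGroup V] [NormedSpace ℝ V]
    {P b : M₁ → V} {Q a : M₂ → V} {u : M₁ → M₂ → ℝ} (ζ : V →L[ℝ] ℝ)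
    (hP : MDifferentiable (𝓡 n₁) 𝓘(ℝ, V) P) (hQ : MDifferentiable (𝓡 n₂) 𝓘(ℝ, V) Q)
    (hu₁ : ∀ y, MDifferentiable (𝓡 n₁) 𝓘(ℝ, ℝ) fun x => u x y)
    (hu₂ : ∀ x, MDifferentiable (𝓡 n₂) 𝓘(ℝ, ℝ) fun y => u x y)
    (hζ : ∀ x y, ζ (P x + Q y) ≠ 0) (h : ∀ x y, u x y • (P x + Q y) = b x - a y)
    (hind : ∀ (x : M₁) (y : M₂) (X : 𝔼 n₁) (Y : 𝔼 n₂) (c : ℝ),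
      c • (P x + Q y) + (vectorDifferential n₁ P x X + vectorDifferential n₂ Q y Y) = 0 →
        X = 0 ∧ Y = 0) : ∃ C, ∀ x y, u x y = C := by
  have key := smul_eq_zero_of_smul_add_eq ζ hP hQ hu₁ hu₂ hζ h hind
  have : Nonempty (Fin n₁) := ⟨⟨0, h₁⟩⟩
  have : Nonempty (Fin n₂) := ⟨⟨0, h₂⟩⟩
  obtain ⟨X, hX⟩ := exists_ne (0 : 𝔼 n₁)
  obtain ⟨Y, hY⟩ := exists_ne (0 : 𝔼 n₂)
  obtain ⟨x₀⟩ : Nonempty M₁ := inferInstance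
  obtain ⟨y₀⟩ : Nonempty M₂ := inferInstance
  refine ⟨u x₀ y₀, fun x y => ?_⟩
  have h1 : u x y = u x₀ y := by
    refine eq_of_vectorDifferential_eq_zero (n := n₁) (k := fun x => u x y) (fun x' => ?_) x x₀
    have h3 := (hu₁ y x').hasDifferentialAt
    convert h3 using 1
    ext Z
    exact ((smul_eq_zero.1 (key x' y Z Y).2).resolve_right hY).symm
  have h2 : u x₀ y = u x₀ y₀ := by
    refine eq_of_vectorDifferential_eq_zero (n := n₂) (k := fun y => u x₀ y) (fun y' => ?_) y y₀
    have h3 := (hu₂ x₀ y').hasDifferentialAt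
    convert h3 using 1
    ext Z
    exact ((smul_eq_zero.1 (key x₀ y' X Z).1).resolve_right hX).symm
  rw [h1, h2]

/-- A Darboux transform of an immersion `h` of a product is conformally congruent to `h` if the null
lift of `h` is, up to a factor, a sum of functions of the two variables. -/
theorem conformallyCongruent_ribaucour [IsManifold (𝓡 n₁) ∞ M₁] [ConnectedSpace M₁]
    [IsManifold (𝓡 n₂) ∞ M₂] [ConnectedSpace M₂] (h₁ : 1 < n₁) (h₂ : 1 < n₂) {N : ℕ}
    {h F : M₁ × M₂ → 𝔼 N} {φ lam mu : M₁ × M₂ → ℝ}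
    {P : M₁ → 𝔼 N × ℝ × ℝ} {Q : M₂ → 𝔼 N × ℝ × ℝ} {σ : M₁ × M₂ → ℝ}
    (hh : ContMDiff ((𝓡 n₁).prod (𝓡 n₂)) 𝓘(ℝ, 𝔼 N) ∞ h)
    (hF : ContMDiff ((𝓡 n₁).prod (𝓡 n₂)) 𝓘(ℝ, 𝔼 N) ∞ F)
    (hφ : ContMDiff ((𝓡 n₁).prod (𝓡 n₂)) 𝓘(ℝ, ℝ) ∞ φ)
    (hP : MDifferentiable (𝓡 n₁) 𝓘(ℝ, 𝔼 N × ℝ × ℝ) P)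
    (hQ : MDifferentiable (𝓡 n₂) 𝓘(ℝ, 𝔼 N × ℝ × ℝ) Q)
    (hlift : ∀ x y, nullLift (h (x, y)) = σ (x, y) • (P x + Q y))
    (hinj : ∀ x y X Y, vectorDifferential n₁ (fun x => h (x, y)) x X +
      vectorDifferential n₂ (fun y => h (x, y)) y Y = 0 → X = 0 ∧ Y = 0)
    (hF₁ : ∀ x y, vectorDifferential n₁ (fun x => F (x, y)) x =
      lam (x, y) • vectorDifferential n₁ (fun x => h (x, y)) x)
    (hF₂ : ∀ x y, vectorDifferential n₂ (fun y => F (x, y)) y =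
      mu (x, y) • vectorDifferential n₂ (fun y => h (x, y)) y)
    (hφ₁ : ∀ x y X, vectorDifferential n₁ (fun x => φ (x, y)) x X =
      inner ℝ (F (x, y)) (vectorDifferential n₁ (fun x => h (x, y)) x X))
    (hφ₂ : ∀ x y Y, vectorDifferential n₂ (fun y => φ (x, y)) y Y =
      inner ℝ (F (x, y)) (vectorDifferential n₂ (fun y => h (x, y)) y Y))
    (hF0 : ∀ p, F p ≠ 0) (hφ0 : ∀ p, φ p ≠ 0) (hne : ∀ p, lam p ≠ mu p)
    (hsum : ∀ p, lam p + mu p = ‖F p‖ ^ 2 / φ p) :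
    ConformallyCongruent h fun p => h p - (2 * (inner ℝ (F p) (F p))⁻¹ * φ p) • F p := by
  have hi₁ : ∀ y : M₂, ContMDiff (𝓡 n₁) ((𝓡 n₁).prod (𝓡 n₂)) ∞ fun x : M₁ => (x, y) :=
    fun y => contMDiff_id.prodMk contMDiff_const
  have hi₂ : ∀ x : M₁, ContMDiff (𝓡 n₂) ((𝓡 n₁).prod (𝓡 n₂)) ∞ fun y : M₂ => (x, y) :=
    fun x => contMDiff_const.prodMk contMDiff_id
  have hd₁ : ∀ {V : Type} [NormedAddCommGroup V] [NormedSpace ℝ V] {k : M₁ × M₂ → V},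
      ContMDiff ((𝓡 n₁).prod (𝓡 n₂)) 𝓘(ℝ, V) ∞ k →
        ∀ y, MDifferentiable (𝓡 n₁) 𝓘(ℝ, V) fun x => k (x, y) :=
    fun hk y => (hk.comp (hi₁ y)).mdifferentiable (by simp)
  have hd₂ : ∀ {V : Type} [NormedAddCommGroup V] [NormedSpace ℝ V] {k : M₁ × M₂ → V},
      ContMDiff ((𝓡 n₁).prod (𝓡 n₂)) 𝓘(ℝ, V) ∞ k →
        ∀ x, MDifferentiable (𝓡 n₂) 𝓘(ℝ, V) fun y => k (x, y) :=
    fun hk x => (hk.comp (hi₂ x)).mdifferentiable (by simp)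
  have hinj₁ : ∀ x y X, vectorDifferential n₁ (fun x => h (x, y)) x X = 0 → X = 0 :=
    fun x y X hX => (hinj x y X 0 (by rw [hX, map_zero, add_zero])).1
  have hinj₂ : ∀ x y Y, vectorDifferential n₂ (fun y => h (x, y)) y Y = 0 → Y = 0 :=
    fun x y Y hY => (hinj x y 0 Y (by rw [hY, map_zero, add_zero])).2
  -- On each slice the factor is constant and the additive vector depends only on the slice: `lam =
  -- c₁ y` with `a y`, and `mu = c₂ x` with `b x`.
  have hA := fun y => exists_sphereLift_eq_smul_add h₁ (c := fun x => lam (x, y))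
    (hh.comp (hi₁ y)) (hF.comp (hi₁ y)) (hφ.comp (hi₁ y)) (fun x => hinj₁ x y)
    (fun x => hF₁ x y) (fun x => hφ₁ x y)
  have hB := fun x => exists_sphereLift_eq_smul_add h₂ (c := fun y => mu (x, y))
    (hh.comp (hi₂ x)) (hF.comp (hi₂ x)) (hφ.comp (hi₂ x)) (hinj₂ x) (hF₂ x) (hφ₂ x)
  choose c₁ a hA using hA
  choose c₂ b hB using hB
  simp only [Function.comp_apply] at hA hB
  -- The middle coordinate, equal to `1` on null lifts; it determines `σ` as the inverse of `ζ (P +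
  -- Q)`.
  let ζ : 𝔼 N × ℝ × ℝ →L[ℝ] ℝ :=
    (ContinuousLinearMap.fst ℝ ℝ ℝ).comp (ContinuousLinearMap.snd ℝ (𝔼 N) (ℝ × ℝ))
  have hθ : ∀ x y, σ (x, y) * ζ (P x + Q y) = 1 := fun x y =>
    (congrArg (fun w => w.2.1) (hlift x y)).symm
  have hζ0 : ∀ x y, ζ (P x + Q y) ≠ 0 := fun x y => right_ne_zero_of_mul_eq_one (hθ x y)
  have hσ0 : ∀ p, σ p ≠ 0 := fun p => left_ne_zero_of_mul_eq_one (hθ p.1 p.2)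
  have hσζ : ∀ x y, σ (x, y) = (ζ (P x + Q y))⁻¹ := fun x y => eq_inv_of_mul_eq_one_left (hθ x y)
  have hθ₁ : ∀ y, MDifferentiable (𝓡 n₁) 𝓘(ℝ, 𝔼 N × ℝ × ℝ) fun x => P x + Q y := fun y x =>
    ((hP x).hasDifferentialAt.add (HasDifferentialAt.const (Q y) x)).mdifferentiableAt
  have hθ₂ : ∀ x, MDifferentiable (𝓡 n₂) 𝓘(ℝ, 𝔼 N × ℝ × ℝ) fun y => P x + Q y := fun x y =>
    ((HasDifferentialAt.const (P x) y).add (hQ y).hasDifferentialAt).mdifferentiableAt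
  have hσ₁ : ∀ y, MDifferentiable (𝓡 n₁) 𝓘(ℝ, ℝ) fun x => σ (x, y) := fun y x => by
    simp only [hσζ]
    exact (HasDifferentialAt.comp ζ.hasFDerivAt
      (hθ₁ y x).hasDifferentialAt).mdifferentiableAt.inv_real (hζ0 x y)
  have hσ₂ : ∀ x, MDifferentiable (𝓡 n₂) 𝓘(ℝ, ℝ) fun y => σ (x, y) := fun x y => by
    simp only [hσζ]
    exact (HasDifferentialAt.comp ζ.hasFDerivAt
      (hθ₂ x y).hasDifferentialAt).mdifferentiableAt.inv_real (hζ0 x y)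
  have hu : ∀ x y, ((lam (x, y) - mu (x, y)) * σ (x, y)) • (P x + Q y) = b x - a y :=
    fun x y => by
      rw [mul_smul, ← hlift, sub_smul, (hA y x).1, (hB x y).1, sub_eq_sub_iff_add_eq_add,
        ← (hA y x).2, add_comm, ← (hB x y).2]
  obtain ⟨C, hC⟩ : ∃ C, ∀ x y, (lam (x, y) - mu (x, y)) * σ (x, y) = C := by
    refine exists_eq_const_of_smul_add_eq (by omega) (by omega) ζ hP hQ (fun y x => ?_)
      (fun x y => ?_) hζ0 hu fun x y X Y c hc => ?_
    -- Along `M₁` the difference `lam - mu` equals `2 c₁ - ‖F‖² / φ`, which is visibly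
    -- differentiable; symmetrically along `M₂`.
    · have h3 := ((HasDifferentialAt.const (2 * c₁ y) x).sub
        ((hd₁ hF y x).norm_sq_div (hd₁ hφ y x) (hφ0 _)).hasDifferentialAt).smul
        (hσ₁ y x).hasDifferentialAt
      convert h3.mdifferentiableAt using 1
      ext1 x'
      rw [← hsum, (hA y x').1, smul_eq_mul]
      ring
    · have h3 := ((((hd₂ hF x y).norm_sq_div (hd₂ hφ x y) (hφ0 _)).hasDifferentialAt).sub
        (HasDifferentialAt.const (2 * c₂ x) y)).smul (hσ₂ x y).hasDifferentialAt
      convert h3.mdifferentiableAt using 1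
      ext1 y'
      rw [← hsum, (hB x y').1, smul_eq_mul]
      ring
    -- General position: modulo `P + Q`, the derivatives of `P` and `Q` are those of the lift of
    -- `h`. Their middle coordinate is zero while that of `P + Q` is not, so a relation reduces to
    -- one between the partial derivatives of the immersion `h`.
    · obtain ⟨s, t, hst⟩ := exists_vectorDifferential_eq_of_nullLift_eq_smul (hd₁ hh y x)
        (hθ₁ y x) (hσ₁ y x) (fun q => hlift q y) X
      obtain ⟨s', t', hst'⟩ := exists_vectorDifferential_eq_of_nullLift_eq_smul (hd₂ hh x y)
        (hθ₂ x y) (hσ₂ x y) (fun q => hlift x q) Y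
      rw [((hP x).hasDifferentialAt.add (HasDifferentialAt.const (Q y) x)).eq, add_zero] at hst
      rw [((HasDifferentialAt.const (P x) y).add (hQ y).hasDifferentialAt).eq, zero_add] at hst'
      have h3 : ((vectorDifferential n₁ (fun x => h (x, y)) x X, 0, t) : 𝔼 N × ℝ × ℝ) +
          (vectorDifferential n₂ (fun y => h (x, y)) y Y, 0, t') =
            (s + s' - σ (x, y) * c) • (P x + Q y) := by
        rw [hst, hst', ← sub_eq_zero, ← smul_zero (σ (x, y)), ← hc]
        module
      have h4 : (s + s' - σ (x, y) * c) * ζ (P x + Q y) = 0 := by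
        exact (congrArg (fun w => w.2.1) h3).symm.trans (add_zero 0)
      rw [(mul_eq_zero.1 h4).resolve_right (hζ0 x y), zero_smul] at h3
      exact hinj x y X Y (congrArg Prod.fst h3)
  obtain ⟨x₀⟩ : Nonempty M₁ := inferInstance
  obtain ⟨y₀⟩ : Nonempty M₂ := inferInstance
  have hC0 : C ≠ 0 := by
    rw [← hC x₀ y₀]
    exact mul_ne_zero (sub_ne_zero.2 (hne _)) (hσ0 _)
  have : Nonempty (Fin n₁) := ⟨⟨0, by omega⟩⟩
  have : Nonempty (Fin n₂) := ⟨⟨0, by omega⟩⟩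
  refine conformallyCongruent_of_lift_eq_add (P := fun x => C⁻¹ • b x) (Q := fun y => -C⁻¹ • a y)
    (s := fun p => (σ p)⁻¹) (t := fun p => C⁻¹ * (‖F p‖ ^ 2 / φ p))
    (fun p => ?_) (fun p => inv_ne_zero (hσ0 p)) (fun p => ?_) (fun p => ?_)
    (fun y => ?_) (fun x => ?_)
  · have h3 := hu p.1 p.2
    rw [hC] at h3
    rw [neg_smul, ← sub_eq_add_neg, ← smul_sub, ← h3, smul_smul, inv_mul_cancel₀ hC0, hlift,
      smul_smul, inv_mul_cancel₀ (hσ0 p)]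
  -- In `(lam + mu) nullLift h - 2 G`, one copy of `G` is expanded along each slice; only `-(a + b)`
  -- survives.
  · have h3 := (hA p.2 p.1).2
    have h4 := (hB p.1 p.2).2
    rw [mul_smul, smul_nullLift_ribaucour (hF0 p) (hφ0 p), ← hsum, (hA p.2 p.1).1,
      (hB p.1 p.2).1, two_smul]
    nth_rewrite 1 [h3]
    rw [h4]
    module
  · exact mul_ne_zero (inv_ne_zero hC0)
      (div_ne_zero (pow_ne_zero 2 (norm_ne_zero_iff.2 (hF0 p))) (hφ0 p))
  · by_contra! hcon
    obtain ⟨X, hX⟩ := exists_ne (0 : 𝔼 n₁)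
    refine hX (hinj₁ x₀ y X ?_)
    rw [funext fun x => hcon x x₀, (HasDifferentialAt.const _ x₀).eq, zero_apply]
  · by_contra! hcon
    obtain ⟨Y, hY⟩ := exists_ne (0 : 𝔼 n₂)
    refine hY (hinj₂ x y₀ Y ?_)
    rw [funext fun y => hcon y y₀, (HasDifferentialAt.const _ y₀).eq, zero_apply]

end Products

/-! ### Conformal maps act linearly on the light cone -/

section Similarity

variable {E : Type*} [NormedAddCommGroup E] [InnerProductSpace ℝ E]

/-- The action of the linear similarity `r U` on the light cone model. -/
def lorentzScale (r : ℝ) (U : E ≃ₗᵢ[ℝ] E) : (E × ℝ × ℝ) →ₗ[ℝ] (E × ℝ × ℝ) :=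
  (r • U.toLinearEquiv.toLinearMap).prodMap (LinearMap.id.prodMap (r ^ 2 • LinearMap.id))

theorem lorentzScale_nullLift (r : ℝ) (U : E ≃ₗᵢ[ℝ] E) (v : E) :
    lorentzScale r U (nullLift v) = nullLift (r • U v) := by
  simp [lorentzScale, nullLift, norm_smul, mul_pow]

theorem exists_linear_nullLift_dilationEquiv (L : E ≃ᵈ E) :
    ∃ A : (E × ℝ × ℝ) →ₗ[ℝ] (E × ℝ × ℝ), ∀ v, nullLift (L v) = A (nullLift v) := by
  set r : ℝ := (Dilation.ratio L : ℝ)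
  have hr : 0 < r := NNReal.coe_pos.2 (Dilation.ratio_pos L)
  have hdist : ∀ v w, ‖L v - L w‖ = r * ‖v - w‖ := fun v w => by
    rw [← dist_eq_norm, ← dist_eq_norm]; exact Dilation.dist_eq L v w
  let U₀ : E ≃ᵢ E := IsometryEquiv.mk' (fun v => r⁻¹ • (L v - L 0)) (fun w => L.symm (r • w + L 0))
    (fun w => by simp [smul_smul, hr.ne']) (Isometry.of_dist_eq fun v w => by
      rw [dist_eq_norm, ← smul_sub, sub_sub_sub_cancel_right, norm_smul, hdist, norm_inv,
        Real.norm_of_nonneg hr.le, inv_mul_cancel_left₀ hr.ne', dist_eq_norm])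
  let U := U₀.toRealLinearIsometryEquivOfMapZero (by
    change r⁻¹ • (L 0 - L 0) = 0
    rw [sub_self, smul_zero])
  refine ⟨lorentzTranslation (L 0) ∘ₗ lorentzScale r U, fun v => ?_⟩
  rw [LinearMap.comp_apply, lorentzScale_nullLift, lorentzTranslation_nullLift]
  have : U v = r⁻¹ • (L v - L 0) := rfl
  rw [this, smul_smul, mul_inv_cancel₀ hr.ne', one_smul, sub_add_cancel]

theorem exists_linear_nullLift_inversion (p₀ : E) (R : ℝ) :
    ∃ A : (E × ℝ × ℝ) →ₗ[ℝ] (E × ℝ × ℝ), ∀ v, v ≠ p₀ → ∃ s : ℝ,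
      nullLift (EuclideanGeometry.inversion p₀ R v) = s • A (nullLift v) := by
  refine ⟨lorentzTranslation p₀ ∘ₗ lorentzScale (R ^ 2) (LinearIsometryEquiv.refl ℝ E) ∘ₗ
    lorentzSwap ∘ₗ lorentzTranslation (-p₀), fun v hv => ⟨(‖v - p₀‖ ^ 2)⁻¹, ?_⟩⟩
  have h0 : ‖v - p₀‖ ≠ 0 := norm_ne_zero_iff.2 (sub_ne_zero.2 hv)
  simp only [LinearMap.comp_apply]
  rw [lorentzTranslation_nullLift, ← sub_eq_add_neg, lorentzSwap_nullLift (sub_ne_zero.2 hv),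
    map_smul, map_smul, lorentzScale_nullLift, lorentzTranslation_nullLift, smul_smul,
    inv_mul_cancel₀ (pow_ne_zero 2 h0), one_smul, EuclideanGeometry.inversion, dist_eq_norm]
  simp [smul_smul, div_eq_mul_inv, mul_pow]

end Similarity

/-- A single linear `A` serves all points, only the scalar varies; therefore additive splittings of
the lift are conformally invariant. -/
theorem ConformallyCongruent.exists_linear_nullLift {X : Type*} {N : ℕ} {g g' : X → 𝔼 N}
    (h : ConformallyCongruent g g') : ∃ A : (𝔼 N × ℝ × ℝ) →ₗ[ℝ] (𝔼 N × ℝ × ℝ), ∀ x, ∃ s : ℝ,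
      nullLift (g' x) = s • A (nullLift (g x)) := by
  rcases h with ⟨L, hL⟩ | ⟨L, p₀, R, -, hne, hL⟩
  · obtain ⟨A, hA⟩ := exists_linear_nullLift_dilationEquiv L
    exact ⟨A, fun x => ⟨1, by rw [hL, hA, one_smul]⟩⟩
  · obtain ⟨A, hA⟩ := exists_linear_nullLift_dilationEquiv L
    obtain ⟨B, hB⟩ := exists_linear_nullLift_inversion p₀ R
    refine ⟨A ∘ₗ B, fun x => ?_⟩
    obtain ⟨s, hs⟩ := hB (g x) (hne x)
    exact ⟨s, by rw [hL, hA, hs, map_smul, LinearMap.comp_apply]⟩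

/-! ### Additive lifts of extrinsic and warped products -/

section Products

variable {n₁ n₂ N : ℕ}
  {M₁ : Type*} [TopologicalSpace M₁] [ChartedSpace (𝔼 n₁) M₁]
  {M₂ : Type*} [TopologicalSpace M₂] [ChartedSpace (𝔼 n₂) M₂]

variable (n₁ n₂) in
/-- The null lift of `g` is, up to a factor, a sum of functions of the two variables. -/
def HasAdditiveLift (g : M₁ × M₂ → 𝔼 N) : Prop :=
  ∃ (P : M₁ → 𝔼 N × ℝ × ℝ) (Q : M₂ → 𝔼 N × ℝ × ℝ) (σ : M₁ × M₂ → ℝ),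
    MDifferentiable (𝓡 n₁) 𝓘(ℝ, 𝔼 N × ℝ × ℝ) P ∧ MDifferentiable (𝓡 n₂) 𝓘(ℝ, 𝔼 N × ℝ × ℝ) Q ∧
      ∀ x y, nullLift (g (x, y)) = σ (x, y) • (P x + Q y)

theorem HasAdditiveLift.congr {g g' : M₁ × M₂ → 𝔼 N} (hg : HasAdditiveLift n₁ n₂ g)
    (h : ConformallyCongruent g g') : HasAdditiveLift n₁ n₂ g' := by
  obtain ⟨P, Q, σ, hP, hQ, hσ⟩ := hg
  obtain ⟨A, hA⟩ := h.exists_linear_nullLift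
  choose s hs using hA
  refine ⟨fun x => A (P x), fun y => A (Q y), fun p => s p * σ p,
    fun x => (HasDifferentialAt.comp (LinearMap.toContinuousLinearMap A).hasFDerivAt
      (hP x).hasDifferentialAt).mdifferentiableAt,
    fun y => (HasDifferentialAt.comp (LinearMap.toContinuousLinearMap A).hasFDerivAt
      (hQ y).hasDifferentialAt).mdifferentiableAt, fun x y => ?_⟩
  rw [hs, hσ, map_smul, smul_smul, map_add]

theorem HasAdditiveLift.of_comp {E₁ E₂ : Type*} [NormedAddCommGroup E₁] [NormedSpace ℝ E₁]
    [NormedAddCommGroup E₂] [NormedSpace ℝ E₂] {g : M₁ × M₂ → 𝔼 N} {g₁ : M₁ → E₁} {g₂ : M₂ → E₂}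
    {p : E₁ → 𝔼 N × ℝ × ℝ} {q : E₂ → 𝔼 N × ℝ × ℝ} {σ : M₁ × M₂ → ℝ}
    (hg₁ : MDifferentiable (𝓡 n₁) 𝓘(ℝ, E₁) g₁) (hg₂ : MDifferentiable (𝓡 n₂) 𝓘(ℝ, E₂) g₂)
    (hp : ∀ x, DifferentiableAt ℝ p (g₁ x)) (hq : ∀ y, DifferentiableAt ℝ q (g₂ y))
    (h : ∀ x y, nullLift (g (x, y)) = σ (x, y) • (p (g₁ x) + q (g₂ y))) :
    HasAdditiveLift n₁ n₂ g :=
  ⟨fun x => p (g₁ x), fun y => q (g₂ y), σ,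
    fun x => (HasDifferentialAt.comp (hp x).hasFDerivAt (hg₁ x).hasDifferentialAt).mdifferentiableAt,
    fun y => (HasDifferentialAt.comp (hq y).hasFDerivAt (hg₂ y).hasDifferentialAt).mdifferentiableAt,
    h⟩

theorem norm_sq_equiv_toLp {l k : ℕ} (e : WithLp 2 (𝔼 l × 𝔼 k) ≃ₗᵢ[ℝ] 𝔼 N) (v : 𝔼 l) (w : 𝔼 k) :
    ‖e (WithLp.toLp 2 (v, w))‖ ^ 2 = ‖v‖ ^ 2 + ‖w‖ ^ 2 := by
  rw [LinearIsometryEquiv.norm_map, WithLp.prod_norm_sq_eq_of_L2]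
  rfl

theorem equiv_toLp_eq_add {l k : ℕ} (e : WithLp 2 (𝔼 l × 𝔼 k) ≃ₗᵢ[ℝ] 𝔼 N) (v : 𝔼 l) (s : ℝ)
    (w : 𝔼 k) : e (WithLp.toLp 2 (v, s • w)) =
      e (WithLp.toLp 2 (v, 0)) + s • e (WithLp.toLp 2 (0, w)) := by
  rw [← map_smul, ← map_add]
  congr 1
  refine WithLp.ofLp_injective 2 (Prod.ext ?_ ?_)
  · change v = v + s • 0
    rw [smul_zero, add_zero]
  · exact (zero_add _).symm

theorem differentiable_equiv_toLp {l k : ℕ} (e : WithLp 2 (𝔼 l × 𝔼 k) ≃ₗᵢ[ℝ] 𝔼 N) :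
    Differentiable ℝ fun v : 𝔼 l × 𝔼 k => e (WithLp.toLp 2 v) :=
  (LinearMap.toContinuousLinearMap (e.toLinearEquiv.toLinearMap ∘ₗ
    (WithLp.linearEquiv 2 ℝ (𝔼 l × 𝔼 k)).symm.toLinearMap)).differentiable

/-- Pythagoras: `‖(v, w)‖² = ‖v‖² + ‖w‖²`, so the lift itself splits. The middle coordinate `1` is
assigned to the first summand. -/
theorem IsExtrinsicProduct.hasAdditiveLift {g : M₁ × M₂ → 𝔼 N}
    (hg : IsExtrinsicProduct n₁ n₂ g) : HasAdditiveLift n₁ n₂ g := by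
  obtain ⟨N₁, N₂, e, g₁, g₂, hg₁, hg₂, h⟩ := hg
  refine HasAdditiveLift.of_comp (σ := fun _ => 1)
    (p := fun v => (e (WithLp.toLp 2 (v, 0)), 1, ‖v‖ ^ 2))
    (q := fun w => (e (WithLp.toLp 2 (0, w)), 0, ‖w‖ ^ 2))
    (hg₁.1.mdifferentiable (by simp)) (hg₂.1.mdifferentiable (by simp)) (fun x => ?_) (fun y => ?_)
    fun x y => ?_
  · exact ((differentiable_equiv_toLp e).comp
      (differentiable_id.prodMk (differentiable_const 0))).differentiableAt.prodMk
      ((differentiableAt_const _).prodMk (differentiableAt_id.norm_sq ℝ))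
  · exact ((differentiable_equiv_toLp e).comp
      ((differentiable_const 0).prodMk differentiable_id)).differentiableAt.prodMk
      ((differentiableAt_const _).prodMk (differentiableAt_id.norm_sq ℝ))
  · rw [one_smul, h, nullLift, norm_sq_equiv_toLp, Prod.mk_add_mk, Prod.mk_add_mk, add_zero,
      ← map_add, ← WithLp.toLp_add, Prod.mk_add_mk, add_zero, zero_add]

/-- Since `‖g₂‖ = 1`, the norm of `g` depends only on `x`. After division by the height `h_m`, the
variable `y` remains only in the term `g₂ y`. -/
theorem IsWarpedProduct.hasAdditiveLift {g : M₁ × M₂ → 𝔼 N}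
    (hg : IsWarpedProduct n₁ n₂ g) : HasAdditiveLift n₁ n₂ g := by
  obtain ⟨l, k, e, g₁, g₂, hg₁, hg₂, hpos, hsphere, h⟩ := hg
  let J : 𝔼 (l + 1) →ₗ[ℝ] 𝔼 l :=
    { toFun := fun v => WithLp.toLp 2 fun i => v i.castSucc
      map_add' := fun _ _ => rfl
      map_smul' := fun _ _ => rfl }
  have hJ : Differentiable ℝ J := (LinearMap.toContinuousLinearMap J).differentiable
  have hlast : Differentiable ℝ fun v : 𝔼 (l + 1) => v (Fin.last l) :=
    (EuclideanSpace.proj (𝕜 := ℝ) (Fin.last l)).differentiable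
  refine HasAdditiveLift.of_comp (σ := fun p => g₁ p.1 (Fin.last l))
    (p := fun v => (v (Fin.last l))⁻¹ •
      ((e (WithLp.toLp 2 (J v, 0)), 1, ‖J v‖ ^ 2 + v (Fin.last l) ^ 2) : 𝔼 N × ℝ × ℝ))
    (q := fun w => (e (WithLp.toLp 2 (0, w)), 0, 0))
    (hg₁.1.mdifferentiable (by simp)) (hg₂.1.mdifferentiable (by simp)) (fun x => ?_) (fun y => ?_)
    fun x y => ?_
  · refine ((hlast _).inv (hpos x).ne').smul ?_
    exact ((differentiable_equiv_toLp e).comp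
      (hJ.prodMk (differentiable_const 0))).differentiableAt.prodMk
      ((differentiableAt_const _).prodMk (((hJ _).norm_sq ℝ).add ((hlast _).pow 2)))
  · exact ((differentiable_equiv_toLp e).comp
      ((differentiable_const 0).prodMk differentiable_id)).differentiableAt.prodMk
      (differentiableAt_const _)
  · have h0 := (hpos x).ne'
    have h1 : g (x, y) = e (WithLp.toLp 2 (J (g₁ x), g₁ x (Fin.last l) • g₂ y)) := h x y
    rw [h1, smul_add, smul_smul, mul_inv_cancel₀ h0, one_smul, nullLift, norm_sq_equiv_toLp,
      norm_smul, hsphere, mul_one, Real.norm_eq_abs, sq_abs, equiv_toLp_eq_add, Prod.smul_mk,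
      Prod.mk_add_mk, Prod.smul_mk, smul_zero, Prod.mk_add_mk, add_zero, add_zero]

end Products

/-! ### Smooth dependence of gradients -/

section Gram

variable {E : Type*} [NormedAddCommGroup E] [InnerProductSpace ℝ E] {n : ℕ}

/-- The Gram operator `A* A` of a linear map, in the standard coordinates. -/
def gramOperator (A : 𝔼 n →L[ℝ] E) : 𝔼 n →L[ℝ] 𝔼 n :=
  ∑ i, ((innerSL ℝ (A (EuclideanSpace.single i 1))).comp A).smulRight (EuclideanSpace.single i 1)

theorem gramOperator_apply (A : 𝔼 n →L[ℝ] E) (w : 𝔼 n) : gramOperator A w =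
    ∑ i, inner ℝ (A (EuclideanSpace.single i 1)) (A w) • EuclideanSpace.single i (1 : ℝ) := by
  simp [gramOperator]

theorem sum_smul_single_apply (c : Fin n → ℝ) (j : Fin n) :
    (∑ i, c i • (EuclideanSpace.single i (1 : ℝ) : 𝔼 n)) j = c j := by
  simp [Pi.single_apply]

/-- A vector in the kernel has image orthogonal to the range of `A`, hence orthogonal to itself. -/
theorem gramOperator_isInvertible {A : 𝔼 n →L[ℝ] E} (hA : Function.Injective A) :
    (gramOperator A).IsInvertible := by
  have hinj : Function.Injective (gramOperator A).toLinearMap := by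
    refine (injective_iff_map_eq_zero _).2 fun w hw => ?_
    have h1 : ∀ i, inner ℝ (A (EuclideanSpace.single i 1)) (A w) = 0 := fun i => by
      have h2 := gramOperator_apply A w
      rw [show gramOperator A w = 0 from hw] at h2
      rw [← sum_smul_single_apply (fun i => inner ℝ (A (EuclideanSpace.single i 1)) (A w)) i, ← h2]
      rfl
    have h3 : ∀ X, inner ℝ (A X) (A w) = 0 := fun X => by
      rw [← (EuclideanSpace.basisFun (Fin n) ℝ).sum_repr X]
      simp [map_sum, sum_inner, inner_smul_left, h1]
    exact hA (by rw [map_zero]; exact inner_self_eq_zero.1 (h3 w))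
  exact ⟨(LinearEquiv.ofInjectiveEndo _ hinj).toContinuousLinearEquiv, by ext; rfl⟩

theorem contDiffAt_gramOperator {A : 𝔼 n → 𝔼 n →L[ℝ] E} {z : 𝔼 n} (hA : ContDiffAt ℝ ∞ A z) :
    ContDiffAt ℝ ∞ (fun y => gramOperator (A y)) z := by
  unfold gramOperator
  refine ContDiffAt.sum fun i _ => ?_
  have h1 : ContDiffAt ℝ ∞ (fun y => A y (EuclideanSpace.single i 1)) z :=
    hA.clm_apply contDiffAt_const
  exact (((innerSL ℝ).contDiff.contDiffAt.comp z h1).clm_comp hA).smulRight contDiffAt_const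

/-- The solution `w` of `⟨A w, A X⟩ = d X` depends smoothly on `A` and `d`. -/
theorem contDiffAt_of_inner_eq {A : 𝔼 n → 𝔼 n →L[ℝ] E} {d : 𝔼 n → 𝔼 n →L[ℝ] ℝ} {w : 𝔼 n → 𝔼 n}
    {U : Set (𝔼 n)} (hU : IsOpen U) (hA : ContDiffOn ℝ ∞ A U) (hd : ContDiffOn ℝ ∞ d U)
    (hinj : ∀ z ∈ U, Function.Injective (A z))
    (h : ∀ z ∈ U, ∀ X, inner ℝ (A z X) (A z (w z)) = d z X) {z : 𝔼 n} (hz : z ∈ U) :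
    ContDiffAt ℝ ∞ w z := by
  have hd' : ContDiffAt ℝ ∞
      (fun y => ∑ i, d y (EuclideanSpace.single i 1) • (EuclideanSpace.single i (1 : ℝ) : 𝔼 n)) z :=
    ContDiffAt.sum fun i _ => ((hd.contDiffAt (hU.mem_nhds hz)).clm_apply contDiffAt_const).smul
      contDiffAt_const
  have hinv := (gramOperator_isInvertible (hinj z hz)).contDiffAt_map_inverse (n := ∞)
  have h1 := (hinv.comp z (contDiffAt_gramOperator (hA.contDiffAt (hU.mem_nhds hz)))).clm_apply hd'
  refine h1.congr_of_eventuallyEq ?_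
  filter_upwards [hU.mem_nhds hz] with y hy
  simp only [Function.comp_apply, ← h y hy, ← gramOperator_apply]
  exact ((gramOperator_isInvertible (hinj y hy)).inverse_apply_eq.2 rfl).symm

end Gram

/-! ### The field and tensor of a Ribaucour transform -/

section Submanifold

variable {n N : ℕ} {M : Type*} [TopologicalSpace M] [ChartedSpace (𝔼 n) M] [IsManifold (𝓡 n) ∞ M]

theorem contMDiff_of_chartAt {V : Type*} [NormedAddCommGroup V] [NormedSpace ℝ V] {k : M → V}
    (hk : ∀ p, ContDiffAt ℝ ∞ (k ∘ (chartAt (𝔼 n) p).symm) (chartAt (𝔼 n) p p)) :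
    ContMDiff (𝓡 n) 𝓘(ℝ, V) ∞ k := fun p => by
  have h1 : ContMDiffAt (𝓡 n) (𝓡 n) ∞ (chartAt (𝔼 n) p) p :=
    (contMDiffOn_chart (x := p)).contMDiffAt
      ((chartAt (𝔼 n) p).open_source.mem_nhds (mem_chart_source _ p))
  refine ((hk p).contMDiffAt.comp p h1).congr_of_eventuallyEq ?_
  filter_upwards [(chartAt (𝔼 n) p).open_source.mem_nhds (mem_chart_source _ p)] with q hq
  simp [(chartAt (𝔼 n) p).left_inv hq]

/-- The gradient is defined pointwise by projections, so its smoothness needs proof: in a chart it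
solves a linear system whose Gram operator is smooth and invertible. -/
theorem contMDiff_differential_grad {f : M → 𝔼 N} (hf : IsSmoothImmersion n f) {φ : M → ℝ}
    (hφ : ContMDiff (𝓡 n) 𝓘(ℝ, ℝ) ∞ φ) :
    ContMDiff (𝓡 n) 𝓘(ℝ, 𝔼 N) ∞ fun p => differential n f p (grad n f φ p) := by
  refine contMDiff_of_chartAt fun p => ?_
  set e := chartAt (𝔼 n) p
  have hfd : ∀ z ∈ e.target, fderiv ℝ (f ∘ e.symm) z =
      (vectorDifferential n f (e.symm z)).comp (chartSymmDeriv n p z) := fun z hz =>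
    (hasFDerivAt_comp_chartAt_symm p hz
      (hf.1.mdifferentiable (by simp) _).hasDifferentialAt).fderiv
  have hφd : ∀ z ∈ e.target, fderiv ℝ (φ ∘ e.symm) z =
      (vectorDifferential n φ (e.symm z)).comp (chartSymmDeriv n p z) := fun z hz =>
    (hasFDerivAt_comp_chartAt_symm p hz
      (hφ.mdifferentiable (by simp) _).hasDifferentialAt).fderiv
  have hex : ∀ z, ∃ w, z ∈ e.target → chartSymmDeriv n p z w = grad n f φ (e.symm z) := fun z => by
    by_cases hz : z ∈ e.target
    · obtain ⟨w, hw⟩ := (chartSymmDeriv_bijective p hz).2 (grad n f φ (e.symm z))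
      exact ⟨w, fun _ => hw⟩
    · exact ⟨0, fun h => absurd h hz⟩
  choose w hw using hex
  have hA : ContDiffOn ℝ ∞ (fderiv ℝ (f ∘ e.symm)) e.target :=
    (contDiffOn_comp_chartAt_symm hf.1 p).fderiv_of_isOpen e.open_target (by simp)
  have hd : ContDiffOn ℝ ∞ (fderiv ℝ (φ ∘ e.symm)) e.target :=
    (contDiffOn_comp_chartAt_symm hφ p).fderiv_of_isOpen e.open_target (by simp)
  have hz : e p ∈ e.target := mem_chart_target _ p
  have hwd := contDiffAt_of_inner_eq e.open_target hA hd
    (fun z hz => by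
      rw [hfd z hz]
      exact (hf.2 (e.symm z)).comp (chartSymmDeriv_bijective p hz).1)
    (fun z hz X => by
      rw [hfd z hz, hφd z hz, real_inner_comm]
      change inner ℝ (vectorDifferential n f (e.symm z) (chartSymmDeriv n p z (w z))) _ = _
      rw [hw z hz]
      exact inducedMetric_grad n hf φ (e.symm z) (chartSymmDeriv n p z X)) hz
  refine ((hA.contDiffAt (e.open_target.mem_nhds hz)).clm_apply hwd).congr_of_eventuallyEq ?_
  filter_upwards [e.open_target.mem_nhds hz] with z hz
  rw [hfd z hz]
  change _ = vectorDifferential n f (e.symm z) (chartSymmDeriv n p z (w z))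
  rw [hw z hz]
  rfl

namespace IsRibaucourTransform

variable {f f' : M → 𝔼 N} {φ : M → ℝ} {β : M → 𝔼 N}

theorem contMDiff_field (hr : IsRibaucourTransform n f f' φ β) (hf : IsSmoothImmersion n f) :
    ContMDiff (𝓡 n) 𝓘(ℝ, 𝔼 N) ∞ (ribaucourField n f φ β) := fun p =>
  (contDiff_fst.add contDiff_snd).contMDiff.contMDiffAt.comp p
    ((contMDiff_differential_grad hf hr.smooth_phi p).prodMk_space (hr.smooth_beta p))

/-- The compatibility condition says exactly that the normal part of `dF` vanishes; the tangential
part is `Hess φ - A_β` by definition. -/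
theorem differential_field (hr : IsRibaucourTransform n f f' φ β) (hf : IsSmoothImmersion n f)
    (p : M) (X : TangentSpace (𝓡 n) p) : differential n (ribaucourField n f φ β) p X =
      differential n f p (codazziTensor n f φ β p X) := by
  have h1 := ((contMDiff_differential_grad hf hr.smooth_phi).mdifferentiable (by simp)
    p).hasDifferentialAt.add (hr.smooth_beta.mdifferentiable (by simp) p).hasDifferentialAt
  have h2 : differential n (ribaucourField n f φ β) p X =
      differential n (fun q => differential n f q (grad n f φ q)) p X + differential n β p X :=
    congrArg (fun A : 𝔼 n →L[ℝ] 𝔼 N => A X) h1.eq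
  have h3 : codazziTensor n f φ β p X =
      tangentialComponent n f p (differential n (ribaucourField n f φ β) p X) := by
    rw [h2, map_add]
    simp [codazziTensor, hess, leviCivita, shapeOperator]
  have h4 : (tangentImage n f p)ᗮ.starProjection
      (differential n (ribaucourField n f φ β) p X) = 0 := by
    rw [h2, map_add]
    exact hr.compat p X
  rw [h3, differential_tangentialComponent n hf]
  have h5 := (tangentImage n f p).starProjection_add_starProjection_orthogonal
    (differential n (ribaucourField n f φ β) p X)
  rw [h4, add_zero] at h5
  exact h5.symm

omit [IsManifold (𝓡 n) ∞ M] in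
theorem differentialReal_eq (hr : IsRibaucourTransform n f f' φ β) (hf : IsSmoothImmersion n f)
    (p : M) (X : TangentSpace (𝓡 n) p) :
    differentialReal n φ p X = inner ℝ (ribaucourField n f φ β p) (differential n f p X) := by
  rw [ribaucourField, inner_add_left, ← inducedMetric_grad n hf, inducedMetric,
    Submodule.inner_left_of_mem_orthogonal (LinearMap.mem_range_self _ X) (hr.normal_beta p),
    add_zero]

/-- From `D X = ρ X` and `D = I - 2νφ S` it follows that `S X = ((1 - ρ) / (2νφ)) X`, and `dF = df ∘
S`. -/
theorem differential_field_of_mem_eigenspace (hr : IsRibaucourTransform n f f' φ β)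
    (hf : IsSmoothImmersion n f) {p : M} (hφ : φ p ≠ 0) {ρ : ℝ} {X : TangentSpace (𝓡 n) p}
    (hX : X ∈ Module.End.eigenspace (ribaucourTensor n f φ β p) ρ) :
    differential n (ribaucourField n f φ β) p X =
      ((1 - ρ) / (2 * nu n f φ β p * φ p)) • differential n f p X := by
  rw [Module.End.mem_eigenspace_iff] at hX
  have hν : nu n f φ β p ≠ 0 := inv_ne_zero (inner_self_ne_zero.2 (hr.field_ne_zero p))
  have hc : 2 * nu n f φ β p * φ p ≠ 0 := mul_ne_zero (mul_ne_zero two_ne_zero hν) hφ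
  rw [hr.differential_field hf, ← map_smul]
  congr 1
  have h1 : X - (2 * nu n f φ β p * φ p) • codazziTensor n f φ β p X = ρ • X := hX
  rw [div_eq_inv_mul, mul_smul, sub_smul, one_smul, ← h1, sub_sub_cancel, smul_smul,
    inv_mul_cancel₀ hc, one_smul]

-- At a zero of `φ` the tensor `D` is the identity, which has no negative eigenvalue.
omit [IsManifold (𝓡 n) ∞ M] in
theorem phi_ne_zero (p : M) {r : ℝ} (hr : 0 < r)
    (h₂ : Module.End.eigenspace (ribaucourTensor n f φ β p) (-r) ≠ ⊥) : φ p ≠ 0 := by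
  intro h0
  obtain ⟨X, hX, hX0⟩ := Submodule.exists_mem_ne_zero_of_ne_bot h₂
  rw [Module.End.mem_eigenspace_iff, ribaucourTensor, h0, mul_zero, zero_smul, sub_zero,
    LinearMap.id_apply] at hX
  have h1 : (1 + r) • X = 0 := by
    rw [add_smul, one_smul]
    nth_rewrite 1 [hX]
    rw [neg_smul, neg_add_cancel]
  exact hX0 ((smul_eq_zero.1 h1).resolve_left (by positivity))

end IsRibaucourTransform

end Submanifold

/-! ### Transfer to the product manifold -/

section Products

variable {n n₁ n₂ N : ℕ}
  {M : Type*} [TopologicalSpace M] [ChartedSpace (𝔼 n) M]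
  {M₁ : Type*} [TopologicalSpace M₁] [ChartedSpace (𝔼 n₁) M₁]
  {M₂ : Type*} [TopologicalSpace M₂] [ChartedSpace (𝔼 n₂) M₂]

theorem mdifferentiable_slice_left (ψ : (M₁ × M₂) ≃ₘ^∞⟮(𝓡 n₁).prod (𝓡 n₂), 𝓡 n⟯ M) (y : M₂) :
    MDifferentiable (𝓡 n₁) (𝓡 n) fun x => ψ (x, y) :=
  (ψ.contMDiff.comp (contMDiff_id.prodMk contMDiff_const)).mdifferentiable (by simp)

theorem mdifferentiable_slice_right (ψ : (M₁ × M₂) ≃ₘ^∞⟮(𝓡 n₁).prod (𝓡 n₂), 𝓡 n⟯ M) (x : M₁) :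
    MDifferentiable (𝓡 n₂) (𝓡 n) fun y => ψ (x, y) :=
  (ψ.contMDiff.comp (contMDiff_const.prodMk contMDiff_id)).mdifferentiable (by simp)

theorem mfderiv_slice_left_injective (ψ : (M₁ × M₂) ≃ₘ^∞⟮(𝓡 n₁).prod (𝓡 n₂), 𝓡 n⟯ M)
    (x : M₁) (y : M₂) : Function.Injective (mfderiv (𝓡 n₁) (𝓡 n) (fun x' => ψ (x', y)) x) := by
  have h1 : MDifferentiable (𝓡 n) (𝓡 n₁) fun q => (ψ.symm q).1 :=
    (contMDiff_fst.comp ψ.symm.contMDiff).mdifferentiable (by simp)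
  have h2 := mfderiv_comp x (h1 (ψ (x, y))) (mdifferentiable_slice_left ψ y x)
  have h3 : (fun q => (ψ.symm q).1) ∘ (fun x' => ψ (x', y)) = id := by ext; simp
  rw [h3, mfderiv_id] at h2
  exact Function.LeftInverse.injective (g := mfderiv (𝓡 n) (𝓡 n₁) (fun q => (ψ.symm q).1) (ψ (x, y)))
    fun X => (congrArg (fun A : 𝔼 n₁ →L[ℝ] 𝔼 n₁ => A X) h2).symm

theorem mfderiv_slice_right_injective (ψ : (M₁ × M₂) ≃ₘ^∞⟮(𝓡 n₁).prod (𝓡 n₂), 𝓡 n⟯ M)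
    (x : M₁) (y : M₂) : Function.Injective (mfderiv (𝓡 n₂) (𝓡 n) (fun y' => ψ (x, y')) y) := by
  have h1 : MDifferentiable (𝓡 n) (𝓡 n₂) fun q => (ψ.symm q).2 :=
    (contMDiff_snd.comp ψ.symm.contMDiff).mdifferentiable (by simp)
  have h2 := mfderiv_comp y (h1 (ψ (x, y))) (mdifferentiable_slice_right ψ x y)
  have h3 : (fun q => (ψ.symm q).2) ∘ (fun y' => ψ (x, y')) = id := by ext; simp
  rw [h3, mfderiv_id] at h2
  exact Function.LeftInverse.injective (g := mfderiv (𝓡 n) (𝓡 n₂) (fun q => (ψ.symm q).2) (ψ (x, y)))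
    fun X => (congrArg (fun A : 𝔼 n₂ →L[ℝ] 𝔼 n₂ => A X) h2).symm

theorem vectorDifferential_comp {m : ℕ} {M' : Type*} [TopologicalSpace M'] [ChartedSpace (𝔼 m) M']
    {V : Type*} [NormedAddCommGroup V] [NormedSpace ℝ V] {k : M → V} {c : M' → M} {x : M'}
    (hk : MDifferentiable (𝓡 n) 𝓘(ℝ, V) k) (hc : MDifferentiableAt (𝓡 m) (𝓡 n) c x) (X : 𝔼 m) :
    vectorDifferential m (fun x => k (c x)) x X =
      vectorDifferential n k (c x) (mfderiv (𝓡 m) (𝓡 n) c x X) :=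
  congrArg (fun A : 𝔼 m →L[ℝ] V => A X) (mfderiv_comp x (hk (c x)) hc)

/-- The sign of `ρ` is left free so that both orders of the net are covered, with `ρ = r` or `ρ =
-r`. -/
theorem conformallyCongruent_of_isProductRepresentation (h₁ : 1 < n₁) (h₂ : 1 < n₂)
    [IsManifold (𝓡 n) ∞ M] [ConnectedSpace M] [IsManifold (𝓡 n₁) ∞ M₁] [IsManifold (𝓡 n₂) ∞ M₂]
    (ψ : (M₁ × M₂) ≃ₘ^∞⟮(𝓡 n₁).prod (𝓡 n₂), 𝓡 n⟯ M)
    {f f' : M → 𝔼 N} (hf : IsSmoothImmersion n f) (hadd : HasAdditiveLift n₁ n₂ (f ∘ ψ))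
    {φ : M → ℝ} {β : M → 𝔼 N} {ρ : M → ℝ} (hr : IsRibaucourTransform n f f' φ β)
    (hφ : ∀ p, φ p ≠ 0) (hρ : ∀ p, ρ p ≠ 0)
    (hψ : IsProductRepresentation ψ
      (fun p => Module.End.eigenspace (ribaucourTensor n f φ β p) (ρ p))
      (fun p => Module.End.eigenspace (ribaucourTensor n f φ β p) (-ρ p))) :
    ConformallyCongruent (f ∘ ψ) (f' ∘ ψ) := by
  have : ConnectedSpace (M₁ × M₂) := ψ.symm.surjective.connectedSpace ψ.symm.continuous
  have : ConnectedSpace M₁ := by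
    obtain ⟨-, y⟩ := Classical.arbitrary (M₁ × M₂)
    exact Function.Surjective.connectedSpace (f := Prod.fst) (fun x => ⟨(x, y), rfl⟩) continuous_fst
  have : ConnectedSpace M₂ := by
    obtain ⟨x, -⟩ := Classical.arbitrary (M₁ × M₂)
    exact Function.Surjective.connectedSpace (f := Prod.snd) (fun y => ⟨(x, y), rfl⟩) continuous_snd
  obtain ⟨P, Q, σ, hP, hQ, hlift⟩ := hadd
  have hF := hr.contMDiff_field hf
  have hfd := hf.1.mdifferentiable (by simp)
  have hFd := hF.mdifferentiable (by simp)
  have hφd := hr.smooth_phi.mdifferentiable (by simp)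
  have hm₁ : ∀ x y (X : 𝔼 n₁), mfderiv (𝓡 n₁) (𝓡 n) (fun x' => ψ (x', y)) x X ∈
      Module.End.eigenspace (ribaucourTensor n f φ β (ψ (x, y))) (ρ (ψ (x, y))) := fun x y X =>
    (hψ x y).1.le <| LinearMap.mem_range_self _ X
  have hm₂ : ∀ x y (Y : 𝔼 n₂), mfderiv (𝓡 n₂) (𝓡 n) (fun y' => ψ (x, y')) y Y ∈
      Module.End.eigenspace (ribaucourTensor n f φ β (ψ (x, y))) (-ρ (ψ (x, y))) := fun x y Y =>
    (hψ x y).2.le <| LinearMap.mem_range_self _ Y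
  have hν : ∀ p, nu n f φ β p ≠ 0 := fun p => inv_ne_zero (inner_self_ne_zero.2 (hr.field_ne_zero p))
  have key := conformallyCongruent_ribaucour h₁ h₂ (h := f ∘ ψ)
    (F := fun p => ribaucourField n f φ β (ψ p)) (φ := fun p => φ (ψ p))
    (lam := fun p => (1 - ρ (ψ p)) / (2 * nu n f φ β (ψ p) * φ (ψ p)))
    (mu := fun p => (1 - -ρ (ψ p)) / (2 * nu n f φ β (ψ p) * φ (ψ p)))
    (hf.1.comp ψ.contMDiff) (hF.comp ψ.contMDiff) (hr.smooth_phi.comp ψ.contMDiff) hP hQ hlift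
    (fun x y X Y hXY => ?_) (fun x y => ?_) (fun x y => ?_) (fun x y X => ?_) (fun x y Y => ?_)
    (fun p => hr.field_ne_zero _) (fun p => hφ _) (fun p => ?_) (fun p => ?_)
  · have h' : f' ∘ ψ = fun p => (f ∘ ψ) p - (2 * (inner ℝ (ribaucourField n f φ β (ψ p))
        (ribaucourField n f φ β (ψ p)))⁻¹ * φ (ψ p)) • ribaucourField n f φ β (ψ p) := by
      ext1 p
      exact hr.eq_transform (ψ p)
    rw [h']
    exact key
  · have hX := vectorDifferential_comp hfd (mdifferentiable_slice_left ψ y x) X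
    have hY := vectorDifferential_comp hfd (mdifferentiable_slice_right ψ x y) Y
    have h0 := (congrArg₂ (· + ·) hX hY).symm.trans hXY
    have hXm := Module.End.mem_eigenspace_iff.1 (hm₁ x y X)
    have hYm := Module.End.mem_eigenspace_iff.1 (hm₂ x y Y)
    set v : TangentSpace (𝓡 n) (ψ (x, y)) := mfderiv (𝓡 n₁) (𝓡 n) (fun x' => ψ (x', y)) x X with hv
    set w : TangentSpace (𝓡 n) (ψ (x, y)) := mfderiv (𝓡 n₂) (𝓡 n) (fun y' => ψ (x, y')) y Y with hw
    have h1 : differential n f (ψ (x, y)) (v + w) = differential n f (ψ (x, y)) 0 := by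
      rw [map_add, map_zero]
      exact h0
    -- The vector `v` then lies in the eigenspaces of both `ρ` and `-ρ`, which meet only in zero.
    have h2 : w = -v := eq_neg_of_add_eq_zero_right (hf.2 _ h1)
    rw [h2, map_neg, hXm, smul_neg, neg_smul, neg_neg, neg_eq_iff_add_eq_zero, ← add_smul] at hYm
    have h3 : v = 0 := (smul_eq_zero.1 hYm).resolve_left fun h => hρ (ψ (x, y)) (by linarith)
    rw [h3, neg_zero] at h2
    exact ⟨mfderiv_slice_left_injective ψ x y (h3.trans (map_zero _).symm),
      mfderiv_slice_right_injective ψ x y (h2.trans (map_zero _).symm)⟩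
  · ext1 X
    refine (vectorDifferential_comp hFd (mdifferentiable_slice_left ψ y x) X).trans ?_
    refine (hr.differential_field_of_mem_eigenspace hf (hφ _) (hm₁ x y X)).trans ?_
    rw [smul_apply]
    exact congrArg _ (vectorDifferential_comp hfd (mdifferentiable_slice_left ψ y x) X).symm
  · ext1 Y
    refine (vectorDifferential_comp hFd (mdifferentiable_slice_right ψ x y) Y).trans ?_
    refine (hr.differential_field_of_mem_eigenspace hf (hφ _) (hm₂ x y Y)).trans ?_
    rw [smul_apply]
    exact congrArg _ (vectorDifferential_comp hfd (mdifferentiable_slice_right ψ x y) Y).symm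
  · refine (vectorDifferential_comp hφd (mdifferentiable_slice_left ψ y x) X).trans ?_
    refine (hr.differentialReal_eq hf _ _).trans ?_
    exact congrArg _ (vectorDifferential_comp hfd (mdifferentiable_slice_left ψ y x) X).symm
  · refine (vectorDifferential_comp hφd (mdifferentiable_slice_right ψ x y) Y).trans ?_
    refine (hr.differentialReal_eq hf _ _).trans ?_
    exact congrArg _ (vectorDifferential_comp hfd (mdifferentiable_slice_right ψ x y) Y).symm
  · have := hν (ψ p)
    have := hφ (ψ p)
    have := hρ (ψ p)
    rw [Ne, div_left_inj' (by positivity)]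
    intro h
    exact hρ (ψ p) (by linarith)
  -- The two eigenvalues `(1 ∓ ρ) / (2νφ)` of `S` add up to `1 / (νφ) = ‖F‖² / φ`.
  · have h1 := hν (ψ p)
    have h2 := hφ (ψ p)
    rw [← real_inner_self_eq_norm_sq, ← inv_inv (inner ℝ _ _)]
    change _ = (nu n f φ β (ψ p))⁻¹ / _
    field_simp
    ring

end Products

end DarbouxTransform

end

theorem mainTheorem6 {n n₁ n₂ N : ℕ} (h₁ : 1 < n₁) (h₂ : 1 < n₂)
    {M : Type*} [TopologicalSpace M] [ChartedSpace (DarbouxTransform.𝔼 n) M]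
    [IsManifold (𝓡 n) ∞ M] [ConnectedSpace M]
    {M₁ : Type*} [TopologicalSpace M₁] [ChartedSpace (DarbouxTransform.𝔼 n₁) M₁]
    [IsManifold (𝓡 n₁) ∞ M₁]
    {M₂ : Type*} [TopologicalSpace M₂] [ChartedSpace (DarbouxTransform.𝔼 n₂) M₂]
    [IsManifold (𝓡 n₂) ∞ M₂]
    (ψ : (M₁ × M₂) ≃ₘ^∞⟮(𝓡 n₁).prod (𝓡 n₂), 𝓡 n⟯ M)
    (f : M → DarbouxTransform.𝔼 N) (hf : DarbouxTransform.IsSmoothImmersion n f)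
    (g : M₁ × M₂ → DarbouxTransform.𝔼 N)
    (hg : DarbouxTransform.IsExtrinsicProduct n₁ n₂ g ∨ DarbouxTransform.IsWarpedProduct n₁ n₂ g)
    (hfg : DarbouxTransform.ConformallyCongruent g (f ∘ ψ))
    (f' : M → DarbouxTransform.𝔼 N)
    (Eplus Eminus : ∀ p : M, Submodule ℝ (TangentSpace (𝓡 n) p))
    (hf' : DarbouxTransform.IsDarbouxTransform n f f' Eplus Eminus)
    (hψ : DarbouxTransform.IsProductRepresentation ψ Eplus Eminus ∨
      DarbouxTransform.IsProductRepresentation ψ Eminus Eplus) :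
    DarbouxTransform.ConformallyCongruent f f' := by
  obtain ⟨φ, β, r, hr, hpos, -, hplus, hminus, -, hne⟩ := hf'
  have hφ : ∀ p, φ p ≠ 0 := fun p =>
    DarbouxTransform.IsRibaucourTransform.phi_ne_zero p (hpos p) (hminus p ▸ hne p)
  have hadd : DarbouxTransform.HasAdditiveLift n₁ n₂ (f ∘ ψ) :=
    (hg.elim (fun h => h.hasAdditiveLift) fun h => h.hasAdditiveLift).congr hfg
  obtain rfl : Eplus = _ := funext hplus
  obtain rfl : Eminus = _ := funext hminus
  have key : DarbouxTransform.ConformallyCongruent (f ∘ ψ) (f' ∘ ψ) := by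
    rcases hψ with hψ | hψ
    · exact DarbouxTransform.conformallyCongruent_of_isProductRepresentation h₁ h₂ ψ hf hadd hr hφ
        (fun p => (hpos p).ne') hψ
    · exact DarbouxTransform.conformallyCongruent_of_isProductRepresentation h₁ h₂ ψ hf hadd hr hφ
        (ρ := fun p => -r p) (fun p => neg_ne_zero.2 (hpos p).ne')
        (by simpa only [neg_neg] using hψ)
  -- The diffeomorphism is removed by evaluating at `ψ.symm p`.
  rcases key with ⟨L, hL⟩ | ⟨L, p₀, R, hR, hne, hL⟩
  · exact Or.inl ⟨L, fun p => by simpa using hL (ψ.symm p)⟩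
  · exact Or.inr ⟨L, p₀, R, hR, fun p => by simpa using hne (ψ.symm p),
      fun p => by simpa using hL (ψ.symm p)⟩
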